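/- A two-way deterministic one-counter automaton (2D1CA) is a two-way deterministic finite automaton, whose head moves on the input enclosed between two end-markers and starts on the left end-marker, with a counter that holds an integer, is initially $0$, can be tested for being zero, and is changed by $-1$, $0$ or $+1$ in each step. Consider single-tape single-head deterministic Turing machines with the tape alphabet $\{a,b,\#\}$, where $\#$ is the blank, such that the input $w\in\{a,b\}^*$ is written between blanks, the head starts on the blank immediately to the right of $w$, and at every time of every computation the non-blank squares of the tape form at most one block of consecutive squares. Such a machine works in space $|w|+2$ if, on every input $w$, its head never leaves the squares that initially contain $\#w\#$. A machine of either kind recognizes a language if it enters its accepting state exactly on the inputs that belong to the language (on other inputs it may reject or run forever). Theorem. If $L\subseteq\{a,b\}^*$ is recognized by such a Turing machine in space $|w|+2$, then the unary language $$\left\{\, a^{100^{1w1}} \;\middle|\; w\in L \,\right\}$$ is recognized by a 2D1CA. Here $1w1$ denotes the natural number whose binary representation (most significant digit first) is obtained from $w$ by replacing $a$ with $0$ and $b$ with $1$ and putting a digit $1$ in front of it and a digit $1$ behind it. -/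

import Mathlib

/-! ### Common notions -/

/-- Movement of a head: one square to the left, no movement, one square to the right. -/
inductive HeadMove
  | left
  | stay
  | right

/-- The displacement caused by a head movement. -/
def HeadMove.shift : HeadMove → ℤ
  | .left => -1
  | .stay => 0
  | .right => 1

/-! ### Two-way deterministic one-counter automata -/

/-- The symbols of the input tape: the two end-markers and the letters of the alphabet `α`. -/
inductive EndMarked (α : Type)
  | leftEnd
  | letter (x : α)
  | rightEnd

/-- The content of the square `i` of the input tape: the left end-marker on the square `0`, the
letters of the input `w` on the squares `1, …, |w|`, and the right end-marker on the square
`|w| + 1`.  (Other squares are never visited; they get an end-marker as a default.) -/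
def inputSquare {α : Type} (w : List α) (i : ℤ) : EndMarked α :=
  if i ≤ 0 then .leftEnd
  else match w[(i - 1).toNat]? with
    | some x => .letter x
    | none => .rightEnd

/-- A two-way deterministic one-counter automaton over the input alphabet `α`.  The transition
`δ s σ z` is used in state `s` when the head reads `σ`; the Boolean `z` is `true` if and only if the
value of the counter is zero.  It yields the next state, the head movement and the number from
`{-1, 0, 1}` which is added to the counter.  Values of `δ` at the accepting and rejecting states are
never used, see `TwoD1CA.step`. -/
structure TwoD1CA (α : Type) where
  /-- the set of states -/
  State : Type
  finite_state : Finite State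
  start : State
  accept : State
  reject : State
  accept_ne_reject : accept ≠ reject
  δ : State → EndMarked α → Bool → State × HeadMove × SignType
  leftEnd_move : ∀ s z, (δ s .leftEnd z).2.1 ≠ .left
  rightEnd_move : ∀ s z, (δ s .rightEnd z).2.1 ≠ .right

namespace TwoD1CA

variable {α : Type}

/-- A configuration: the state, the position of the input head and the value of the counter. -/
structure Cfg (D : TwoD1CA α) where
  state : D.State
  pos : ℤ
  counter : ℤ

/-- The initial configuration. -/
def init (D : TwoD1CA α) : D.Cfg := ⟨D.start, 0, 0⟩

open Classical in
/-- One step on the input `w`; there is none in the accepting and in the rejecting state. -/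
noncomputable def step (D : TwoD1CA α) (w : List α) (c : D.Cfg) : Option D.Cfg :=
  if c.state = D.accept ∨ c.state = D.reject then none
  else
    let t := D.δ c.state (inputSquare w c.pos) (decide (c.counter = 0))
    some ⟨t.1, c.pos + t.2.1.shift, c.counter + (t.2.2 : ℤ)⟩

/-- The input `w` is accepted: the computation on `w` enters the accepting state. -/
def Accepts (D : TwoD1CA α) (w : List α) : Prop :=
  ∃ c, StateTransition.Reaches (D.step w) D.init c ∧ c.state = D.accept

/-- `D` recognizes `L`: it accepts exactly the members of `L`. -/
def Recognizes (D : TwoD1CA α) (L : Language α) : Prop :=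
  ∀ w, D.Accepts w ↔ w ∈ L

end TwoD1CA

/-! ### Deterministic Turing machines with a binary work alphabet -/

/-- The alphabet `{a, b}`. -/
inductive AB
  | a
  | b

/-- A single-tape single-head deterministic Turing machine with the tape alphabet `{a, b, #}`, where
the blank `#` is `none : Option AB`.  Values of `δ` at the accepting and rejecting states are never
used, see `BinaryDTM.step`. -/
structure BinaryDTM where
  /-- the set of states -/
  State : Type
  finite_state : Finite State
  start : State
  accept : State
  reject : State
  accept_ne_reject : accept ≠ reject
  /-- next state, symbol to write, head movement -/
  δ : State → Option AB → State × Option AB × HeadMove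

namespace BinaryDTM

/-- A configuration: the state, the position of the head and the content of the two-way infinite
tape. -/
structure Cfg (M : BinaryDTM) where
  state : M.State
  pos : ℤ
  tape : ℤ → Option AB

/-- The initial tape: `w` on the squares `1, …, |w|`, and blanks everywhere else. -/
def inputTape (w : List AB) (i : ℤ) : Option AB :=
  if i ≤ 0 then none else w[(i - 1).toNat]?

/-- The initial configuration: the head is on the blank to the right of `w`. -/
def init (M : BinaryDTM) (w : List AB) : M.Cfg := ⟨M.start, w.length + 1, inputTape w⟩

open Classical in
/-- One step; there is none in the accepting and in the rejecting state. -/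
noncomputable def step (M : BinaryDTM) (c : M.Cfg) : Option M.Cfg :=
  if c.state = M.accept ∨ c.state = M.reject then none
  else
    let t := M.δ c.state (c.tape c.pos)
    some ⟨t.1, c.pos + t.2.2.shift, Function.update c.tape c.pos t.2.1⟩

/-- `c` occurs in the computation of `M` on `w`. -/
def Reachable (M : BinaryDTM) (w : List AB) (c : M.Cfg) : Prop :=
  StateTransition.Reaches M.step (M.init w) c

/-- The input `w` is accepted: the computation on `w` enters the accepting state. -/
def Accepts (M : BinaryDTM) (w : List AB) : Prop :=
  ∃ c, M.Reachable w c ∧ c.state = M.accept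

/-- `M` recognizes `L`: it accepts exactly the members of `L`. -/
def Recognizes (M : BinaryDTM) (L : Language AB) : Prop :=
  ∀ w, M.Accepts w ↔ w ∈ L

/-- At every time of every computation, there is at most one block of non-blank symbols: the
non-blank squares are consecutive. -/
def SingleBlock (M : BinaryDTM) : Prop :=
  ∀ w c, M.Reachable w c → {i : ℤ | c.tape i ≠ none}.OrdConnected

/-- `M` works in space `|w| + 2`: on every input `w`, the head never leaves the squares
`0, …, |w| + 1`, which initially contain `#w#`. -/
def InputSpace (M : BinaryDTM) : Prop :=
  ∀ w c, M.Reachable w c → 0 ≤ c.pos ∧ c.pos ≤ w.length + 1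

end BinaryDTM

/-! ### The unary encoding -/

/-- The alphabet `{a}`. -/
inductive Unary
  | a

/-- The binary digit of a letter: `a` is `0` and `b` is `1`. -/
def AB.digit : AB → ℕ
  | .a => 0
  | .b => 1

/-- The value of the binary number `1w1` (most significant digit first). -/
def binaryValue (w : List AB) : ℕ :=
  Nat.ofDigits 2 ([1] ++ w.map AB.digit ++ [1]).reverse

/-! A stack is coded by its bijective base-2 number `stackCode`, and two stacks with the numbers i
and j by the single number 2^i * 3^j, with the exponent of a further factor 5 as scratch space.
Pushing and popping double and halve an exponent; this is done by repeated multiplication with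
fractions such as 5/2 and 4/5, each guarded by a divisibility test (`push_reaches`, `pop_reaches`).
A one-counter automaton does this arithmetic on the position of its head: it walks to the left end,
counting in the counter and, modulo the denominator, in its state, and then trades units of the
counter for moves to the right (`auto_simulates`).

The obstacle is space: the number must stay at most n = 100^m, where m is the value of 1w1. Since
2^i * 3^j * 5^k ≤ 25^m if i + j + k ≤ 2m, and a push yields a sum of at most 2(i + j + 1), it
suffices that i + j + 1 ≤ m before every operation. Now m ≥ 2^(|w|+1), and a stack of height at most
|w| - 1 has a number below 2^|w|. The stacks that hold the two halves of the tape may have height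
|w| + 2, so the lowest three symbols of each are kept in the finite control (`buffered_simulates`).

Stacks over {a, b} suffice because each half of the tape is a gap of blanks followed by a word. The
gap goes into the finite control, so it needs a bound independent of w (`exists_gap_bound`). A head
with a blank between itself and the block reads only blanks ahead and must write blanks, for a
letter would start a second block. Hence its walk is determined by its state and side at the start.
The space bound makes each such walk that occurs bounded, and there are finitely many states and
sides.

The values of 1w1 are exactly the odd m ≥ 3. All other input lengths are rejected (`prep_rejects`);
100^m is turned into 2^(m-1), and m - 1 is the number of a stack that holds w below a final b
(`binaryValue_eq`).

The layers are composed through `Agrees`, which preserves both verdicts and divergence, so that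
nonacceptance is inherited as well. Space limits are part of the step functions: a violation leaves
the machine stuck, which is neither a verdict nor divergence. Each simulation therefore has to show
that its target stays within its limit. -/

/-! ### Forward simulations of deterministic transition systems -/

section Simulation

open StateTransition

variable {σ τ υ : Type*}

/-- The computation from `a` enters a configuration with property `P`. -/
def Leads (f : σ → Option σ) (a : σ) (P : σ → Prop) : Prop :=
  ∃ a', Reaches f a a' ∧ P a'

/-- The computation from `a` never halts. -/
def Diverges (f : σ → Option σ) (a : σ) : Prop :=
  ∀ a', Reaches f a a' → f a' ≠ none

/-- Each step of `f` is matched by at least one step of `g`. -/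
def Simulates (f : σ → Option σ) (g : τ → Option τ) (R : σ → τ → Prop) : Prop :=
  ∀ a b, R a b → ∀ a', f a = some a' → ∃ b', R a' b' ∧ Reaches₁ g b b'

/-- The computation of `g` from `b` has each verdict that the computation of `f` from `a` has, and
it diverges if the latter does. -/
def Agrees (f : σ → Option σ) (vf : σ → Bool → Prop) (a : σ)
    (g : τ → Option τ) (vg : τ → Bool → Prop) (b : τ) : Prop :=
  (∀ v, Leads f a (vf · v) → Leads g b (vg · v)) ∧ (Diverges f a → Diverges g b)

theorem Reaches.of_step {f : σ → Option σ} {a b : σ} (h : f a = some b) : Reaches f a b :=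
  Relation.ReflTransGen.single h

theorem Reaches₁.of_step {f : σ → Option σ} {a b : σ} (h : f a = some b) : Reaches₁ f a b :=
  Relation.TransGen.single h

theorem Reaches.cons {f : σ → Option σ} {a b c : σ} (h : f a = some b) (h' : Reaches f b c) :
    Reaches f a c :=
  Relation.ReflTransGen.head h h'

theorem Reaches₁.cons {f : σ → Option σ} {a b c : σ} (h : f a = some b) (h' : Reaches f b c) :
    Reaches₁ f a c :=
  Relation.TransGen.head' h h'

theorem Reaches₁.ne_none {f : σ → Option σ} {a b : σ} (h : Reaches₁ f a b) : f a ≠ none := by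
  obtain ⟨c, hc, -⟩ := Relation.TransGen.head'_iff.1 h
  intro h0
  rw [h0] at hc
  simp at hc

theorem Leads.of_reaches {f : σ → Option σ} {a b : σ} {P : σ → Prop} (h : Reaches f a b)
    (hb : Leads f b P) : Leads f a P := by
  obtain ⟨c, hc, hP⟩ := hb
  exact ⟨c, h.trans hc, hP⟩

/-- By determinism, a configuration reachable from `a` either comes after `b` or has a successor on
the way to `b`. -/
theorem Diverges.of_reaches {f : σ → Option σ} {a b : σ} (h : Reaches f a b)
    (hb : Diverges f b) : Diverges f a := by
  intro c hc
  rcases reaches_total h hc with hbc | hcb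
  · exact hb c hbc
  · rcases Relation.reflTransGen_iff_eq_or_transGen.1 hcb with rfl | h1
    · exact hb _ .refl
    · exact Reaches₁.ne_none h1

theorem Diverges.reaches {f : σ → Option σ} {a b : σ} (ha : Diverges f a)
    (h : Reaches f a b) : Diverges f b :=
  fun c hc => ha c (h.trans hc)

/-- The verdict is final: a computation with a verdict in a halting configuration neither diverges
nor has another verdict. -/
theorem Leads.unique {f : σ → Option σ} {a : σ} {P Q : σ → Prop} (hP : ∀ c, P c → f c = none)
    (hQ : ∀ c, Q c → f c = none) (h : Leads f a P) (h' : Leads f a Q) : ∃ c, P c ∧ Q c := by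
  obtain ⟨c, hc, hPc⟩ := h
  obtain ⟨d, hd, hQd⟩ := h'
  have key : ∀ x y, f x = none → Reaches f x y → x = y := by
    intro x y hx hxy
    rcases Relation.reflTransGen_iff_eq_or_transGen.1 hxy with rfl | h1
    · rfl
    · exact absurd hx (Reaches₁.ne_none h1)
  rcases reaches_total hc hd with hcd | hdc
  · obtain rfl := key _ _ (hP c hPc) hcd
    exact ⟨_, hPc, hQd⟩
  · obtain rfl := key _ _ (hQ d hQd) hdc
    exact ⟨_, hPc, hQd⟩

theorem Simulates.reaches {f : σ → Option σ} {g : τ → Option τ} {R : σ → τ → Prop}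
    (hs : Simulates f g R) {a a' : σ} {b : τ} (hR : R a b) (h : Reaches f a a') :
    ∃ b', R a' b' ∧ Reaches g b b' := by
  induction h with
  | refl => exact ⟨b, hR, .refl⟩
  | tail _ hcd ih =>
    obtain ⟨c', hc', hbc'⟩ := ih
    obtain ⟨d', hd', hcd'⟩ := hs _ _ hc' _ hcd
    exact ⟨d', hd', hbc'.trans hcd'.to_reflTransGen⟩

theorem Simulates.diverges {f : σ → Option σ} {g : τ → Option τ} {R : σ → τ → Prop}
    (hs : Simulates f g R) {a : σ} {b : τ} (hR : R a b) (h : Diverges f a) : Diverges g b := by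
  have next : ∀ a b, R a b → Diverges f a → ∃ a' b', R a' b' ∧ Diverges f a' ∧
      Reaches₁ g b b' := by
    intro a b hR h
    obtain ⟨a', ha'⟩ := Option.ne_none_iff_exists'.1 (h a .refl)
    obtain ⟨b', hb', hbb'⟩ := hs _ _ hR _ ha'
    exact ⟨a', b', hb', h.reaches (Reaches.of_step ha'), hbb'⟩
  -- A related pair always lies strictly ahead. This needs every step of `f` to cost at least one
  -- step of `g`.
  have inv : ∀ b', Reaches g b b' → ∃ a₁ b₁, R a₁ b₁ ∧ Diverges f a₁ ∧ Reaches₁ g b' b₁ := by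
    intro b' hb'
    induction hb' with
    | refl => exact next a b hR h
    | tail _ hcd ih =>
      obtain ⟨a₁, b₁, h₁, h₂, h₃⟩ := ih
      obtain ⟨a₂, b₂, h₄, h₅, h₆⟩ := next a₁ b₁ h₁ h₂
      exact ⟨a₂, b₂, h₄, h₅, h₆.trans_right (reaches₁_fwd h₃ hcd)⟩
  intro b' hb'
  obtain ⟨_, _, _, _, h₃⟩ := inv b' hb'
  exact Reaches₁.ne_none h₃

theorem Simulates.agrees {f : σ → Option σ} {vf : σ → Bool → Prop} {g : τ → Option τ}
    {vg : τ → Bool → Prop} {R : σ → τ → Prop} (hs : Simulates f g R)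
    (hv : ∀ a b v, R a b → vf a v → Leads g b (vg · v)) {a : σ} {b : τ} (hR : R a b) :
    Agrees f vf a g vg b := by
  refine ⟨?_, hs.diverges hR⟩
  rintro v ⟨a', ha', hv'⟩
  obtain ⟨b', hb', hbb'⟩ := hs.reaches hR ha'
  exact Leads.of_reaches hbb' (hv _ _ _ hb' hv')

theorem Agrees.trans {f : σ → Option σ} {vf : σ → Bool → Prop} {a : σ} {g : τ → Option τ}
    {vg : τ → Bool → Prop} {b : τ} {h : υ → Option υ} {vh : υ → Bool → Prop} {c : υ}
    (h₁ : Agrees f vf a g vg b) (h₂ : Agrees g vg b h vh c) : Agrees f vf a h vh c :=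
  ⟨fun v hv => h₂.1 v (h₁.1 v hv), fun hd => h₂.2 (h₁.2 hd)⟩

theorem Agrees.of_reaches {f : σ → Option σ} {vf : σ → Bool → Prop} {a : σ} {g : τ → Option τ}
    {vg : τ → Bool → Prop} {b c : τ} (h : Reaches g b c) (h' : Agrees f vf a g vg c) :
    Agrees f vf a g vg b :=
  ⟨fun v hv => Leads.of_reaches h (h'.1 v hv), fun hd => Diverges.of_reaches h (h'.2 hd)⟩

end Simulation

/-! ### Machines that multiply and divide one number -/

/-- The instructions of a machine whose memory is one natural number `V`. -/
inductive FracInstr (S : Type)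
  /-- if `den` divides `V`, replace `V` by `V / den * num` and go to `yes`, otherwise to `no` -/
  | frac (num den : Fin 101) (yes no : S)
  /-- if `V` is positive, decrease it and go to `yes`, otherwise to `no` -/
  | dec (yes no : S)
  /-- replace `V` by the input number -/
  | reload (next : S)
  | halt (verdict : Bool)

/-- A machine whose memory is one natural number. -/
structure FracMachine where
  State : Type
  finite_state : Finite State
  start : State
  instr : State → FracInstr State

namespace FracMachine

/-- One step on the input number `n`.  The machine gets stuck when its number would exceed `n`, or
when it divides by zero. -/
def step (F : FracMachine) (n : ℕ) (c : F.State × ℕ) : Option (F.State × ℕ) :=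
  match F.instr c.1 with
  | .frac num den yes no =>
    if den.val = 0 then none
    else if den.val ∣ c.2 then
      if c.2 / den.val * num.val ≤ n then some (yes, c.2 / den.val * num.val) else none
    else some (no, c.2)
  | .dec yes no => if c.2 = 0 then some (no, 0) else some (yes, c.2 - 1)
  | .reload next => some (next, n)
  | .halt _ => none

/-- The configuration `c` is halting with the given verdict. -/
def Verdict (F : FracMachine) (c : F.State × ℕ) (v : Bool) : Prop :=
  F.instr c.1 = .halt v

end FracMachine

/-! ### A one-counter automaton whose head position is the number -/

/-- The stages of the simulation of an instruction of a `FracMachine`. -/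
inductive FracPhase
  /-- the position of the head is the number, and the counter is zero -/
  | main
  /-- moving to the right end -/
  | reload
  /-- moving to the left end, counting in the counter and, modulo the denominator, in `r` -/
  | count (r : Fin 101)
  /-- the head of the loop that moves the number back -/
  | loop (divides : Bool)
  /-- decreasing the counter by `k` -/
  | decr (divides : Bool) (k : Fin 101)
  /-- moving the head by `k` to the right -/
  | incr (divides : Bool) (k : Fin 101)

namespace FracPhase

/-- An injective code. -/
def toTuple : FracPhase → Fin 6 × Bool × Fin 101
  | main => (0, false, 0)
  | reload => (1, false, 0)
  | count r => (2, false, r)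
  | loop d => (3, d, 0)
  | decr d k => (4, d, k)
  | incr d k => (5, d, k)

instance : Finite FracPhase :=
  Finite.of_injective toTuple (by
    intro a b h; cases a <;> cases b <;> simp_all [toTuple])

end FracPhase

namespace FracMachine

/-- The predecessor, truncated at zero. -/
def finPred (k : Fin 101) : Fin 101 := ⟨k.val - 1, by omega⟩

/-- The residue after one more unit has been counted. -/
def nextResidue (den r : Fin 101) : Fin 101 := Fin.ofNat 101 ((r.val + 1) % den.val)

/-- The residue after `t` units have been counted. -/
def residue (den : Fin 101) (t : ℕ) : Fin 101 := Fin.ofNat 101 (t % den.val)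

theorem residue_val (den : Fin 101) (hd : den.val ≠ 0) (t : ℕ) :
    (residue den t).val = t % den.val :=
  Nat.mod_eq_of_lt ((Nat.mod_lt _ (Nat.pos_of_ne_zero hd)).trans den.isLt)

theorem residue_zero (den : Fin 101) : residue den 0 = 0 := by
  simp [residue]

theorem nextResidue_residue (den : Fin 101) (hd : den.val ≠ 0) (t : ℕ) :
    nextResidue den (residue den t) = residue den (t + 1) := by
  rw [nextResidue, residue_val _ hd, Nat.mod_add_mod, residue]

/-- Forbid moving off the right end. -/
def guardRight : EndMarked Unary → HeadMove
  | .rightEnd => .stay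
  | _ => .right

/-- The transition function of the one-counter automaton that simulates `F`. -/
def autoδ (F : FracMachine) :
    (F.State × FracPhase) ⊕ Bool → EndMarked Unary → Bool →
      ((F.State × FracPhase) ⊕ Bool) × HeadMove × SignType
  | .inr v, _, _ => (.inr v, .stay, 0)
  | .inl (s, ph), σ, z =>
    match F.instr s, ph with
    | .halt v, _ => (.inr v, .stay, 0)
    | .reload _, .main => (.inl (s, .reload), .stay, 0)
    | .reload next, _ =>
      match σ with
      | .rightEnd => (.inl (next, .main), .left, 0)
      | _ => (.inl (s, .reload), .right, 0)
    | .dec yes no, _ =>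
      match σ with
      | .leftEnd => (.inl (no, .main), .stay, 0)
      | _ => (.inl (yes, .main), .left, 0)
    | .frac _ _ _ _, .main => (.inl (s, .count 0), .stay, 0)
    | .frac _ _ _ _, .reload => (.inl (s, .count 0), .stay, 0)
    | .frac _ den _ _, .count r =>
      match σ with
      | .leftEnd => (.inl (s, .loop (decide (r = 0))), .stay, 0)
      | _ => (.inl (s, .count (nextResidue den r)), .left, 1)
    | .frac _ den yes no, .loop d =>
      if z then (.inl (if d then yes else no, .main), .stay, 0)
      else (.inl (s, .decr d (if d then den else 1)), .stay, 0)
    | .frac num _ _ _, .decr d k =>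
      if k = 0 then (.inl (s, .incr d (if d then num else 1)), .stay, 0)
      else (.inl (s, .decr d (finPred k)), .stay, -1)
    | .frac _ _ _ _, .incr d k =>
      if k = 0 then (.inl (s, .loop d), .stay, 0)
      else (.inl (s, .incr d (finPred k)), guardRight σ, 0)

/-- The one-counter automaton that simulates `F`. -/
def auto (F : FracMachine) : TwoD1CA Unary where
  State := (F.State × FracPhase) ⊕ Bool
  finite_state := by
    have := F.finite_state
    infer_instance
  start := .inl (F.start, .main)
  accept := .inr true
  reject := .inr false
  accept_ne_reject := by simp
  δ := F.autoδ
  leftEnd_move := by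
    rintro (⟨s, ph⟩ | v) z
    · simp only [autoδ]
      rcases h : F.instr s with ⟨n, d, y, m⟩ | ⟨y, m⟩ | s' | v <;>
        rcases ph with _ | _ | r | b | ⟨b, k⟩ | ⟨b, k⟩ <;> simp [guardRight] <;> split_ifs <;> simp
    · simp [autoδ]
  rightEnd_move := by
    rintro (⟨s, ph⟩ | v) z
    · simp only [autoδ]
      rcases h : F.instr s with ⟨n, d, y, m⟩ | ⟨y, m⟩ | s' | v <;>
        rcases ph with _ | _ | r | b | ⟨b, k⟩ | ⟨b, k⟩ <;> simp [guardRight] <;> split_ifs <;> simp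
    · simp [autoδ]

open StateTransition

variable (F : FracMachine) (n : ℕ)

/-- The input word. -/
def unaryInput (n : ℕ) : List Unary := List.replicate n .a

theorem inputSquare_left (i : ℤ) (h : i ≤ 0) : inputSquare (unaryInput n) i = .leftEnd := by
  simp [inputSquare, h]

theorem inputSquare_letter (i : ℤ) (h : 0 < i) (h' : i ≤ n) :
    inputSquare (unaryInput n) i = .letter .a := by
  have h1 : i.toNat - 1 < n := by omega
  simp [inputSquare, unaryInput, h1, not_le.2 h]

theorem inputSquare_right (i : ℤ) (h : n < i) : inputSquare (unaryInput n) i = .rightEnd := by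
  have h1 : ¬ i.toNat - 1 < n := by omega
  have h2 : ¬ i ≤ 0 := by omega
  simp [inputSquare, unaryInput, h1, h2]

/-- A configuration of the automaton inside the simulation. -/
def autoCfg (s : F.State) (ph : FracPhase) (p c : ℤ) : F.auto.Cfg :=
  ⟨(.inl (s, ph) : (F.State × FracPhase) ⊕ Bool), p, c⟩

theorem auto_step (s : F.State) (ph : FracPhase) (p c : ℤ) :
    F.auto.step (unaryInput n) (F.autoCfg s ph p c) =
      some ⟨(F.autoδ (.inl (s, ph)) (inputSquare (unaryInput n) p) (decide (c = 0))).1,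
        p + (F.autoδ (.inl (s, ph)) (inputSquare (unaryInput n) p) (decide (c = 0))).2.1.shift,
        c + (F.autoδ (.inl (s, ph)) (inputSquare (unaryInput n) p) (decide (c = 0))).2.2⟩ := by
  have h : ¬ ((F.autoCfg s ph p c).state = F.auto.accept ∨
      (F.autoCfg s ph p c).state = F.auto.reject) := by
    simp [autoCfg, auto]
  rw [TwoD1CA.step, if_neg h]
  rfl

/-- The number is the position of the head. -/
def AutoRel (c : F.State × ℕ) (d : F.auto.Cfg) : Prop :=
  c.2 ≤ n ∧ d = F.autoCfg c.1 .main c.2 0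

variable {F n}

section Frac

variable {s : F.State} {num den : Fin 101} {yes no : F.State}

/-- For the induction, `t` units have already been counted modulo `den`, and `p` squares remain. -/
theorem count_reaches (hs : F.instr s = .frac num den yes no) (hd : den.val ≠ 0) (c : ℤ) (p : ℕ)
    (hp : p ≤ n) (t : ℕ) :
    Reaches (F.auto.step (unaryInput n))
      (F.autoCfg s (.count (residue den t)) p c)
      (F.autoCfg s (.loop (decide (den.val ∣ t + p))) 0 (c + p)) := by
  induction p generalizing t c with
  | zero =>
    refine Reaches.of_step ?_
    rw [auto_step, inputSquare_left _ _ (by simp)]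
    have : residue den t = 0 ↔ den.val ∣ t := by
      rw [Fin.ext_iff, residue_val _ hd, Nat.dvd_iff_mod_eq_zero, Fin.val_zero]
    simp [autoδ, hs, HeadMove.shift, autoCfg, this]
  | succ p ih =>
    refine Reaches.cons ?_ (?_ : Reaches _ (F.autoCfg s (.count (residue den (t + 1)))
      p (c + 1)) _)
    · rw [auto_step, inputSquare_letter _ _ (by omega) (by omega)]
      simp [autoδ, hs, HeadMove.shift, autoCfg, nextResidue_residue _ hd]
    · have := ih (c + 1) (by omega) (t + 1)
      convert this using 2
      · congr 2
        simp [add_comm, add_left_comm]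
      · push_cast; ring

theorem decr_reaches (hs : F.instr s = .frac num den yes no) (d : Bool) (k : ℕ) (hk : k < 101)
    (p c : ℤ) :
    Reaches (F.auto.step (unaryInput n)) (F.autoCfg s (.decr d ⟨k, hk⟩) p c)
      (F.autoCfg s (.incr d (if d then num else 1)) p (c - k)) := by
  induction k generalizing c with
  | zero =>
    refine Reaches.of_step ?_
    rw [auto_step]
    simp [autoδ, hs, HeadMove.shift, autoCfg]
  | succ k ih =>
    refine Reaches.cons ?_ (?_ : Reaches _ (F.autoCfg s (.decr d ⟨k, by omega⟩) p (c - 1)) _)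
    · rw [auto_step]
      simp [autoδ, hs, HeadMove.shift, autoCfg, finPred, Fin.ext_iff, sub_eq_add_neg]
    · convert ih (by omega) (c - 1) using 2
      push_cast; ring

theorem incr_reaches (hs : F.instr s = .frac num den yes no) (d : Bool) (k : ℕ) (hk : k < 101)
    (p c : ℤ) (hp : p + k ≤ n) :
    Reaches (F.auto.step (unaryInput n)) (F.autoCfg s (.incr d ⟨k, hk⟩) p c)
      (F.autoCfg s (.loop d) (p + k) c) := by
  induction k generalizing p with
  | zero =>
    refine Reaches.of_step ?_
    rw [auto_step]
    simp [autoδ, hs, HeadMove.shift, autoCfg]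
  | succ k ih =>
    refine Reaches.cons ?_ (?_ : Reaches _ (F.autoCfg s (.incr d ⟨k, by omega⟩) (p + 1) c) _)
    · rw [auto_step]
      -- At least one move is still due, so the head is left of square `n` and the guard is
      -- inactive.
      have h : guardRight (inputSquare (unaryInput n) p) = .right := by
        rcases le_or_gt p 0 with h | h
        · rw [inputSquare_left _ _ h]; rfl
        · rw [inputSquare_letter _ _ h (by push_cast at hp; omega)]; rfl
      simp [autoδ, hs, HeadMove.shift, autoCfg, finPred, Fin.ext_iff, h]
    · convert ih (by omega) (p + 1) (by push_cast at hp; omega) using 2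
      push_cast; ring

/-- Each round trades `x` units of the counter for `y` squares. With `x = y = 1` the same loop
restores a number that failed the divisibility test. -/
theorem loop_reaches (hs : F.instr s = .frac num den yes no) (d : Bool) (x y : Fin 101)
    (hx : x = if d then den else 1) (hy : y = if d then num else 1) (hx0 : x.val ≠ 0)
    (p q : ℕ) (hp : p + q * y.val ≤ n) :
    Reaches (F.auto.step (unaryInput n)) (F.autoCfg s (.loop d) p ((q * x.val : ℕ) : ℤ))
      (F.autoCfg (if d then yes else no) .main ((p + q * y.val : ℕ) : ℤ) 0) := by
  induction q generalizing p with
  | zero =>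
    refine Reaches.of_step ?_
    rw [auto_step]
    simp [autoδ, hs, HeadMove.shift, autoCfg]
  | succ q ih =>
    refine Reaches.cons (b := F.autoCfg s (.decr d x) p (((q + 1) * x.val : ℕ) : ℤ)) ?_ ?_
    · rw [auto_step]
      have : ¬ ((((q + 1) * x.val : ℕ) : ℤ) = 0) := by
        have : (q + 1) * x.val ≠ 0 := Nat.mul_ne_zero (by omega) hx0
        exact_mod_cast this
      simp only [this, decide_false]
      simp [autoδ, hs, HeadMove.shift, autoCfg, hx]
    have h1 := decr_reaches (n := n) hs d x.val x.isLt p (((q + 1) * x.val : ℕ) : ℤ)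
    rw [← hy] at h1
    have h2 := incr_reaches (n := n) hs d y.val y.isLt p (((q + 1) * x.val : ℕ) - (x.val : ℕ) : ℤ)
      (by have : (q + 1) * y.val = q * y.val + y.val := by ring
          rw [this] at hp
          have h0 : 0 ≤ q * y.val := Nat.zero_le _
          zify at hp h0
          linarith)
    have h3 := ih (p + y.val) (by
      have : (q + 1) * y.val = q * y.val + y.val := by ring
      omega)
    have e1 : ((((q + 1) * x.val : ℕ) : ℤ) - (x.val : ℕ) : ℤ) = ((q * x.val : ℕ) : ℤ) := by
      push_cast; ring
    have e2 : p + (q + 1) * y.val = p + y.val + q * y.val := by ring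
    rw [e2]
    refine (h1.trans h2).trans ?_
    rw [e1]
    exact_mod_cast h3

end Frac

theorem reload_reaches {s next : F.State} (hs : F.instr s = .reload next) (p : ℕ) (k : ℕ)
    (hp : p + k = n + 1) :
    Reaches (F.auto.step (unaryInput n)) (F.autoCfg s .reload p 0)
      (F.autoCfg next .main n 0) := by
  induction k generalizing p with
  | zero =>
    refine Reaches.of_step ?_
    rw [auto_step, inputSquare_right _ _ (by omega)]
    obtain rfl : p = n + 1 := by omega
    simp [autoδ, hs, HeadMove.shift, autoCfg]
  | succ k ih =>
    refine Reaches.cons (b := F.autoCfg s .reload ((p + 1 : ℕ) : ℤ) 0) ?_ (ih (p + 1) (by omega))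
    rw [auto_step]
    rcases Nat.eq_zero_or_pos p with rfl | h
    · rw [inputSquare_left _ _ (by simp)]
      simp [autoδ, hs, HeadMove.shift, autoCfg]
    · rw [inputSquare_letter _ _ (by omega) (by omega)]
      simp [autoδ, hs, HeadMove.shift, autoCfg]

theorem auto_simulates (F : FracMachine) (n : ℕ) :
    Simulates (F.step n) (F.auto.step (unaryInput n)) (F.AutoRel n) := by
  rintro ⟨s, V⟩ d ⟨hV, rfl⟩ c' hc
  simp only [step] at hc
  dsimp only at hV
  rcases hs : F.instr s with ⟨num, den, yes, no⟩ | ⟨yes, no⟩ | next | v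
  · simp only [hs] at hc
    split_ifs at hc with hd hdvd hle
    all_goals
      have h0 : F.auto.step (unaryInput n) (F.autoCfg s .main V 0) =
          some (F.autoCfg s (.count (residue den 0)) V 0) := by
        rw [auto_step]
        simp [autoδ, hs, HeadMove.shift, autoCfg, residue_zero]
      have h1 := count_reaches (n := n) hs hd 0 V hV 0
      rw [zero_add, zero_add] at h1
    · cases hc
      refine ⟨_, ⟨hle, rfl⟩, Reaches₁.cons h0 (h1.trans ?_)⟩
      have h2 := loop_reaches (n := n) hs true den num rfl rfl hd 0 (V / den.val) (by simpa using hle)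
      rw [Nat.div_mul_cancel hdvd] at h2
      simp only [hdvd, decide_true]
      simp only [zero_add, if_true, Nat.cast_zero] at h2
      exact h2
    · cases hc
      refine ⟨_, ⟨hV, rfl⟩, Reaches₁.cons h0 (h1.trans ?_)⟩
      have h2 := loop_reaches (n := n) hs false 1 1 rfl rfl (by simp) 0 V (by simpa using hV)
      simp only [hdvd, decide_false]
      simp at h2
      exact h2
  · simp only [hs] at hc
    split_ifs at hc with h0
    · cases hc
      subst h0
      refine ⟨_, ⟨hV, rfl⟩, Reaches₁.of_step ?_⟩
      rw [auto_step, inputSquare_left _ _ (by simp)]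
      simp [autoδ, hs, HeadMove.shift, autoCfg]
    · cases hc
      refine ⟨_, ⟨?_, rfl⟩, Reaches₁.of_step ?_⟩
      · simp only; omega
      rw [auto_step, inputSquare_letter _ _ (by simp; omega) (by simpa using hV)]
      obtain ⟨k, rfl⟩ := Nat.exists_eq_succ_of_ne_zero h0
      simp [autoδ, hs, HeadMove.shift, autoCfg]
  · simp only [hs] at hc
    cases hc
    refine ⟨_, ⟨le_rfl, rfl⟩, Reaches₁.cons (b := F.autoCfg s .reload V 0) ?_
      (reload_reaches hs V (n + 1 - V) (by omega))⟩
    rw [auto_step]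
    simp [autoδ, hs, HeadMove.shift, autoCfg]
  · simp [hs] at hc

/-- The verdicts of the automaton. -/
def AutoVerdict (F : FracMachine) (d : F.auto.Cfg) (v : Bool) : Prop :=
  d.state = (.inr v : (F.State × FracPhase) ⊕ Bool)

theorem auto_agrees (F : FracMachine) (n : ℕ) :
    Agrees (F.step n) F.Verdict (F.start, 0) (F.auto.step (unaryInput n)) F.AutoVerdict
      F.auto.init := by
  refine (auto_simulates F n).agrees ?_ (⟨Nat.zero_le _, rfl⟩ : F.AutoRel n (F.start, 0) _)
  rintro ⟨s, V⟩ d v ⟨-, rfl⟩ hv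
  refine ⟨_, Reaches.of_step (F.auto_step n s .main V 0), ?_⟩
  have hs : F.instr s = .halt v := hv
  simp only [AutoVerdict, autoδ, hs]
  rfl

end FracMachine

/-! ### Machines with two stacks -/

/-- The instructions of a machine with two stacks over the alphabet `{a, b}`. -/
inductive StackInstr (S : Type)
  | push (side : Bool) (x : AB) (next : S)
  | pop (side : Bool) (next : Option AB → S)
  | nop (next : S)
  | halt (verdict : Bool)

/-- A machine with two stacks over the alphabet `{a, b}`. -/
structure StackMachine where
  State : Type
  finite_state : Finite State
  start : State
  instr : State → StackInstr State

namespace StackMachine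

/-- A configuration: the state and the stacks, with their tops at the heads of the lists. -/
abbrev Cfg (P : StackMachine) := P.State × (Bool → List AB)

open Classical in
/-- One step.  The machine gets stuck when the content of the stacks violates `ok`. -/
noncomputable def step (P : StackMachine) (ok : (Bool → List AB) → Prop) (c : P.Cfg) :
    Option P.Cfg :=
  if ok c.2 then
    match P.instr c.1 with
    | .push side x next => some (next, Function.update c.2 side (x :: c.2 side))
    | .pop side next => some (next (c.2 side).head?, Function.update c.2 side (c.2 side).tail)
    | .nop next => some (next, c.2)
    | .halt _ => none
  else none

/-- The configuration `c` is halting with the given verdict. -/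
def Verdict (P : StackMachine) (c : P.Cfg) (v : Bool) : Prop :=
  P.instr c.1 = .halt v

end StackMachine

instance : Finite AB :=
  Finite.of_injective (fun x : AB => match x with | .a => true | .b => false) (by
    intro x y h; cases x <;> cases y <;> simp_all)

/-- The bijective base-2 number of a stack, whose top is the least significant digit. -/
def stackCode : List AB → ℕ
  | [] => 0
  | x :: l => 2 * stackCode l + 1 + x.digit

theorem AB.digit_le_one (x : AB) : x.digit ≤ 1 := by cases x <;> simp [AB.digit]

/-- The stacks of height h have the numbers from 2^h - 1 to 2^(h+1) - 2; this is the upper end, and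
the next lemma is the lower one. -/
theorem stackCode_add_two_le (l : List AB) : stackCode l + 2 ≤ 2 ^ (l.length + 1) := by
  induction l with
  | nil => simp [stackCode]
  | cons x l ih =>
    have := x.digit_le_one
    simp only [stackCode, List.length_cons]
    rw [pow_succ]
    omega

theorem two_pow_length_le (l : List AB) : 2 ^ l.length ≤ stackCode l + 1 := by
  induction l with
  | nil => simp [stackCode]
  | cons x l ih =>
    simp only [stackCode, List.length_cons]
    rw [pow_succ]
    omega

theorem exists_stackCode_eq (n : ℕ) : ∃ l, stackCode l = n := by
  induction n using Nat.strong_induction_on with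
  | _ n ih =>
    rcases Nat.eq_zero_or_pos n with rfl | hn
    · exact ⟨[], rfl⟩
    · obtain ⟨l, hl⟩ := ih ((n - 1) / 2) (by omega)
      rcases Nat.mod_two_eq_zero_or_one (n - 1) with h | h
      · exact ⟨.a :: l, by simp only [stackCode, hl, AB.digit]; omega⟩
      · exact ⟨.b :: l, by simp only [stackCode, hl, AB.digit]; omega⟩

/-! ### Registers as exponents -/

/-- The prime whose exponent is the number of a stack. -/
def stackPrime : Bool → ℕ
  | false => 2
  | true => 3

theorem stackPrime_prime (a : Bool) : (stackPrime a).Prime := by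
  cases a <;> norm_num [stackPrime]

/-- The contents of the registers of the stack `a`, of the other stack, and of an auxiliary
register, as one number. -/
def register (a : Bool) (i j k : ℕ) : ℕ := stackPrime a ^ i * stackPrime (!a) ^ j * 5 ^ k

/-- Allows the stack that is operated on to be listed first, whichever side it is. -/
theorem register_swap (a : Bool) (i j k : ℕ) : register (!a) j i k = register a i j k := by
  simp only [register, Bool.not_not]
  ring

/-- All bases are at most 5, and 5^2 ≤ 100. The factor 2 is the room for the doubling in a push. -/
theorem register_le_pow {a : Bool} {i j k m : ℕ} (h : i + j + k ≤ 2 * m) :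
    register a i j k ≤ 100 ^ m := by
  have h5 : ∀ a, stackPrime a ≤ 5 := by intro a; cases a <;> norm_num [stackPrime]
  calc register a i j k ≤ 5 ^ i * 5 ^ j * 5 ^ k := by
        unfold register
        gcongr <;> apply h5
    _ = 5 ^ (i + j + k) := by rw [pow_add, pow_add]
    _ ≤ 5 ^ (2 * m) := Nat.pow_le_pow_right (by norm_num) h
    _ = 25 ^ m := by rw [pow_mul]; norm_num
    _ ≤ 100 ^ m := Nat.pow_le_pow_left (by norm_num) m

theorem pow_dvd_pow_mul_iff {p c : ℕ} (hp : 1 < p) (hc : Nat.Coprime p c) (t i : ℕ) :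
    p ^ t ∣ p ^ i * c ↔ t ≤ i := by
  constructor
  · intro h
    exact (Nat.pow_dvd_pow_iff_le_right hp).1
      (Nat.Coprime.dvd_of_dvd_mul_right (Nat.Coprime.pow_left _ hc) h)
  · intro h
    exact Dvd.dvd.mul_right (pow_dvd_pow p h) c

theorem stackPrime_pow_dvd_register (a : Bool) (t i j k : ℕ) :
    stackPrime a ^ t ∣ register a i j k ↔ t ≤ i := by
  rw [register, mul_assoc]
  refine pow_dvd_pow_mul_iff (stackPrime_prime a).one_lt ?_ t i
  refine Nat.Coprime.mul_right (Nat.Coprime.pow_right _ ?_) (Nat.Coprime.pow_right _ ?_) <;>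
    cases a <;> norm_num [stackPrime]

theorem five_dvd_register (a : Bool) (i j k : ℕ) : 5 ∣ register a i j k ↔ 1 ≤ k := by
  rw [register, mul_comm]
  have h : Nat.Coprime 5 (stackPrime a ^ i * stackPrime (!a) ^ j) := by
    refine Nat.Coprime.mul_right (Nat.Coprime.pow_right _ ?_) (Nat.Coprime.pow_right _ ?_) <;>
      cases a <;> norm_num [stackPrime]
  simpa using pow_dvd_pow_mul_iff (by norm_num) h 1 k

/-! ### Simulation of a stack machine by a machine with one number -/

/-- The stages of the simulation of an instruction of a `StackMachine`. -/
inductive StackMode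
  | enter
  | back
  | finish
  | odd
  | even
  | ret (x : AB)

instance : Finite StackMode :=
  Finite.of_injective
    (fun m : StackMode => (match m with
      | .enter => (0, .a) | .back => (1, .a) | .finish => (2, .a) | .odd => (3, .a)
      | .even => (4, .a) | .ret x => (5, x) : Fin 6 × AB)) (by
    intro x y h; cases x <;> cases y <;> simp_all)

/-- The states of the preparatory phase, which checks that the input is `100 ^ m` for an odd
`m ≥ 3` and turns it into `2 ^ (m - 1)`. -/
inductive PrepState
  | load
  | nonzero
  | reloadFirst
  /-- counting the divisions by `100`, up to `4` and modulo `2` from `3` on -/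
  | count (c : Fin 5)
  | notZero
  | isOne
  | reloadSecond
  | convert
  | half
  | reject

instance : Finite PrepState :=
  Finite.of_injective
    (fun m : PrepState => (match m with
      | .load => (0, 0) | .nonzero => (1, 0) | .reloadFirst => (2, 0) | .count c => (3, c)
      | .notZero => (4, 0) | .isOne => (5, 0) | .reloadSecond => (6, 0) | .convert => (7, 0)
      | .half => (8, 0) | .reject => (9, 0) : Fin 10 × Fin 5)) (by
    intro x y h; cases x <;> cases y <;> simp_all)

namespace StackMachine

/-- A small power as a constant of an instruction. -/
def constPow (a : Bool) (k : ℕ) : Fin 101 := Fin.ofNat 101 (stackPrime a ^ k)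

theorem constPow_val (a : Bool) {k : ℕ} (hk : k ≤ 2) : (constPow a k).val = stackPrime a ^ k := by
  interval_cases k <;> cases a <;> rfl

/-- The next value of the counter of divisions. -/
def nextCount (c : Fin 5) : Fin 5 := if c = 4 then 3 else c + 1

/-- The instructions of the preparatory phase. -/
def prepInstr {S : Type} (start : S) : PrepState → FracInstr (PrepState ⊕ S)
  | .load => .reload (.inl .nonzero)
  | .nonzero => .dec (.inl .reloadFirst) (.inl .reject)
  | .reloadFirst => .reload (.inl (.count 0))
  | .count c => .frac 1 100 (.inl (.count (nextCount c)))
      (.inl (if c = 3 then .notZero else .reject))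
  | .notZero => .dec (.inl .isOne) (.inl .reject)
  | .isOne => .dec (.inl .reject) (.inl .reloadSecond)
  | .reloadSecond => .reload (.inl .convert)
  | .convert => .frac 2 100 (.inl .convert) (.inl .half)
  | .half => .frac 1 2 (.inr start) (.inl .reject)
  | .reject => .halt false

/-- The instructions that simulate the stack machine. -/
def runInstr (P : StackMachine) (s : P.State) (mode : StackMode) :
    FracInstr (PrepState ⊕ P.State × StackMode) :=
  match P.instr s, mode with
  | .halt v, _ => .halt v
  | .nop next, _ => .frac 1 1 (.inr (next, .enter)) (.inl .reject)
  | .push a _ _, .enter => .frac 5 (constPow a 1) (.inr (s, .enter)) (.inr (s, .back))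
  | .push a _ _, .back => .frac (constPow a 2) 5 (.inr (s, .back)) (.inr (s, .finish))
  | .push a x next, _ => .frac (constPow a (1 + x.digit)) 1 (.inr (next, .enter)) (.inl .reject)
  | .pop a _, .enter => .frac 5 (constPow a 2) (.inr (s, .enter)) (.inr (s, .odd))
  | .pop a _, .odd => .frac 1 (constPow a 1) (.inr (s, .ret .a)) (.inr (s, .even))
  | .pop _ next, .even => .frac 1 5 (.inr (s, .ret .b)) (.inr (next none, .enter))
  | .pop a next, .ret x => .frac (constPow a 1) 5 (.inr (s, .ret x))
      (.inr (next (some x), .enter))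
  | .pop _ _, _ => .halt false

/-- The machine with one number that simulates the stack machine `P`. -/
def toFrac (P : StackMachine) : FracMachine where
  State := PrepState ⊕ P.State × StackMode
  finite_state := by
    have := P.finite_state
    infer_instance
  start := .inl .load
  instr
    | .inl p => prepInstr (P.start, .enter) p
    | .inr (s, mode) => P.runInstr s mode

end StackMachine

namespace FracMachine

variable {F : FracMachine} {n : ℕ} {s : F.State}

theorem step_frac_yes {num den : Fin 101} {yes no : F.State} (hs : F.instr s = .frac num den yes no)
    (hd : den.val ≠ 0) {V W V' : ℕ} (hV : V = den.val * W) (hV' : V' = W * num.val) (h : V' ≤ n) :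
    F.step n (s, V) = some (yes, V') := by
  subst hV hV'
  simp only [step, hs, hd, if_false, dvd_mul_right, if_true]
  rw [Nat.mul_div_cancel_left _ (Nat.pos_of_ne_zero hd), if_pos h]

theorem step_frac_no {num den : Fin 101} {yes no : F.State} (hs : F.instr s = .frac num den yes no)
    (hd : den.val ≠ 0) {V : ℕ} (hV : ¬ den.val ∣ V) : F.step n (s, V) = some (no, V) := by
  simp only [step, hs, hd, if_false, hV]

theorem step_dec_zero {yes no : F.State} (hs : F.instr s = .dec yes no) :
    F.step n (s, 0) = some (no, 0) := by
  simp [step, hs]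

theorem step_dec_succ {yes no : F.State} (hs : F.instr s = .dec yes no) (V : ℕ) :
    F.step n (s, V + 1) = some (yes, V) := by
  simp [step, hs]

theorem step_reload {next : F.State} (hs : F.instr s = .reload next) (V : ℕ) :
    F.step n (s, V) = some (next, n) := by
  simp [step, hs]

end FracMachine

namespace StackMachine

open StateTransition FracMachine

variable (P : StackMachine)

/-- A configuration of the machine with one number inside the simulation. -/
def runCfg (s : P.State) (mode : StackMode) (V : ℕ) : P.toFrac.State × ℕ :=
  ((.inr (s, mode) : PrepState ⊕ P.State × StackMode), V)

/-- A configuration of the machine with one number in the preparatory phase. -/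
def prepCfg (p : PrepState) (V : ℕ) : P.toFrac.State × ℕ :=
  ((.inl p : PrepState ⊕ P.State × StackMode), V)

variable {P}

theorem toFrac_instr_inr (s : P.State) (mode : StackMode) :
    P.toFrac.instr (.inr (s, mode) : PrepState ⊕ P.State × StackMode) = P.runInstr s mode := rfl

/-- The stacks are small enough to be represented by a number up to `100 ^ m`. -/
def Fits (m : ℕ) (st : Bool → List AB) : Prop :=
  stackCode (st false) + stackCode (st true) + 1 ≤ m

/-- The number represents the stacks. -/
def FracRel (c : P.Cfg) (d : P.toFrac.State × ℕ) : Prop :=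
  d = P.runCfg c.1 .enter (register false (stackCode (c.2 false)) (stackCode (c.2 true)) 0)

theorem fracRel_iff (a : Bool) (c : P.Cfg) (d : P.toFrac.State × ℕ) :
    FracRel c d ↔
      d = P.runCfg c.1 .enter (register a (stackCode (c.2 a)) (stackCode (c.2 !a)) 0) := by
  cases a
  · rfl
  · rw [FracRel, Bool.not_true, ← register_swap]
    rfl

theorem fits_iff (a : Bool) (m : ℕ) (st : Bool → List AB) :
    Fits m st ↔ stackCode (st a) + stackCode (st !a) + 1 ≤ m := by
  cases a
  · rfl
  · rw [Fits, Bool.not_true, add_comm (stackCode (st false))]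

/-! ### Push and pop as arithmetic on exponents -/

section Instructions

variable {s : P.State} {a : Bool} {m : ℕ}

/-- With p the prime of the stack, the fraction 5/p moves the exponent `i` to the prime 5, p^2/5
moves it back doubled, and one multiplication by p or p^2 adds the new letter. The final exponents
sum to at most 2(i + j + 1) ≤ 2m. -/
theorem push_reaches {x : AB} {next : P.State} (hs : P.instr s = .push a x next) {i j : ℕ}
    (h : i + j + 1 ≤ m) :
    Reaches₁ (P.toFrac.step (100 ^ m)) (P.runCfg s .enter (register a i j 0))
      (P.runCfg next .enter (register a (2 * i + 1 + x.digit) j 0)) := by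
  have hx := x.digit_le_one
  have enter : ∀ i k, i + k + j + 1 ≤ m →
      Reaches (P.toFrac.step (100 ^ m)) (P.runCfg s .enter (register a i j k))
        (P.runCfg s .back (register a 0 j (k + i))) := by
    intro i
    induction i with
    | zero =>
      intro k _
      refine Reaches.of_step (step_frac_no (toFrac_instr_inr s .enter |>.trans (by
        simp only [runInstr, hs]; rfl)) ?_ ?_)
      · rw [constPow_val a (by omega)]; simp [(stackPrime_prime a).ne_zero]
      · rw [constPow_val a (by omega), stackPrime_pow_dvd_register]; omega
    | succ i ih =>
      intro k hk
      refine Reaches.cons (b := P.runCfg s .enter (register a i j (k + 1)))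
        (step_frac_yes (W := register a i j k) (toFrac_instr_inr s .enter |>.trans (by
          simp only [runInstr, hs]; rfl)) ?_ ?_ ?_ (register_le_pow (by omega))) ?_
      · rw [constPow_val a (by omega)]; simp [(stackPrime_prime a).ne_zero]
      · rw [constPow_val a (by omega)]; simp only [register]; ring
      · simp only [register]; simp; ring
      · convert ih (k + 1) (by omega) using 3; ring
  have back : ∀ k i, 2 * k + i + j + 1 ≤ 2 * m →
      Reaches (P.toFrac.step (100 ^ m)) (P.runCfg s .back (register a i j k))
        (P.runCfg s .finish (register a (i + 2 * k) j 0)) := by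
    intro k
    induction k with
    | zero =>
      intro i _
      refine Reaches.of_step (step_frac_no (toFrac_instr_inr s .back |>.trans (by
        simp only [runInstr, hs]; rfl)) (by simp) ?_)
      have : ¬ 5 ∣ register a i j 0 := by rw [five_dvd_register]; omega
      exact this
    | succ k ih =>
      intro i hk
      refine Reaches.cons (b := P.runCfg s .back (register a (i + 2) j k))
        (step_frac_yes (W := register a i j k) (toFrac_instr_inr s .back |>.trans (by
          simp only [runInstr, hs]; rfl)) (by simp) ?_ ?_ (register_le_pow (by omega))) ?_
      · simp only [register]; simp; ring
      · rw [constPow_val a (by omega)]; simp only [register]; ring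
      · convert ih (i + 2) (by omega) using 3; ring
  refine Relation.TransGen.tail' ((enter i 0 (by omega)).trans (back _ 0 (by omega))) ?_
  refine step_frac_yes (W := register a (2 * i) j 0) (toFrac_instr_inr s .finish |>.trans (by
    simp only [runInstr, hs]; rfl)) (by simp) ?_ ?_ (register_le_pow (by omega))
  · simp
  · rw [constPow_val a (by omega)]; simp only [register]; ring

/-- The fraction 5/p^2 divides the exponent by 2, leaving the remainder on p and the quotient on 5;
the popped letter is read off, and p/5 moves the rest back. -/
theorem pop_reaches {next : Option AB → P.State} (hs : P.instr s = .pop a next) (l : List AB)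
    {j : ℕ} (h : stackCode l + j + 1 ≤ m) :
    Reaches₁ (P.toFrac.step (100 ^ m)) (P.runCfg s .enter (register a (stackCode l) j 0))
      (P.runCfg (next l.head?) .enter (register a (stackCode l.tail) j 0)) := by
  have enter : ∀ i k e, e ≤ 1 → 2 * i + e + k + j + 1 ≤ m →
      Reaches (P.toFrac.step (100 ^ m)) (P.runCfg s .enter (register a (2 * i + e) j k))
        (P.runCfg s .odd (register a e j (k + i))) := by
    intro i
    induction i with
    | zero =>
      intro k e he _
      rw [mul_zero, zero_add, add_zero]
      refine Reaches.of_step (step_frac_no (toFrac_instr_inr s .enter |>.trans (by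
        simp only [runInstr, hs]; rfl)) ?_ ?_)
      · rw [constPow_val a (by omega)]; simp [(stackPrime_prime a).ne_zero]
      · rw [constPow_val a (by omega), stackPrime_pow_dvd_register]; omega
    | succ i ih =>
      intro k e he hk
      refine Reaches.cons (b := P.runCfg s .enter (register a (2 * i + e) j (k + 1)))
        (step_frac_yes (W := register a (2 * i + e) j k) (toFrac_instr_inr s .enter |>.trans (by
          simp only [runInstr, hs]; rfl)) ?_ ?_ ?_ (register_le_pow (by omega))) ?_
      · rw [constPow_val a (by omega)]; simp [(stackPrime_prime a).ne_zero]
      · rw [constPow_val a (by omega)]; simp only [register]; ring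
      · simp only [register]; simp; ring
      · convert ih (k + 1) e he (by omega) using 3; ring
  have ret : ∀ x k i, k + i + j + 1 ≤ m →
      Reaches (P.toFrac.step (100 ^ m)) (P.runCfg s (.ret x) (register a i j k))
        (P.runCfg (next (some x)) .enter (register a (i + k) j 0)) := by
    intro x k
    induction k with
    | zero =>
      intro i _
      refine Reaches.of_step (step_frac_no (toFrac_instr_inr s (.ret x) |>.trans (by
        simp only [runInstr, hs]; rfl)) (by simp) ?_)
      have : ¬ 5 ∣ register a i j 0 := by rw [five_dvd_register]; omega
      exact this
    | succ k ih =>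
      intro i hk
      refine Reaches.cons (b := P.runCfg s (.ret x) (register a (i + 1) j k))
        (step_frac_yes (W := register a i j k) (toFrac_instr_inr s (.ret x) |>.trans (by
          simp only [runInstr, hs]; rfl)) (by simp) ?_ ?_ (register_le_pow (by omega))) ?_
      · simp only [register]; simp; ring
      · rw [constPow_val a (by omega)]; simp only [register]; ring
      · convert ih (i + 1) (by omega) using 3; ring
  have odd : ∀ k, k + j + 2 ≤ m → P.toFrac.step (100 ^ m) (P.runCfg s .odd (register a 1 j k)) =
      some (P.runCfg s (.ret .a) (register a 0 j k)) := by
    intro k hk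
    refine step_frac_yes (W := register a 0 j k) (toFrac_instr_inr s .odd |>.trans (by
      simp only [runInstr, hs]; rfl)) ?_ ?_ ?_ (register_le_pow (by omega))
    · rw [constPow_val a (by omega)]; simp [(stackPrime_prime a).ne_zero]
    · rw [constPow_val a (by omega)]; simp only [register]; ring
    · simp
  have odd_no : ∀ k, P.toFrac.step (100 ^ m) (P.runCfg s .odd (register a 0 j k)) =
      some (P.runCfg s .even (register a 0 j k)) := by
    intro k
    refine step_frac_no (toFrac_instr_inr s .odd |>.trans (by
      simp only [runInstr, hs]; rfl)) ?_ ?_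
    · rw [constPow_val a (by omega)]; simp [(stackPrime_prime a).ne_zero]
    · rw [constPow_val a (by omega), stackPrime_pow_dvd_register]; omega
  have even : ∀ k, k + j + 2 ≤ m →
      P.toFrac.step (100 ^ m) (P.runCfg s .even (register a 0 j (k + 1))) =
        some (P.runCfg s (.ret .b) (register a 0 j k)) := by
    intro k hk
    refine step_frac_yes (W := register a 0 j k) (toFrac_instr_inr s .even |>.trans (by
      simp only [runInstr, hs]; rfl)) (by simp) ?_ ?_ (register_le_pow (by omega))
    · simp only [register]; simp; ring
    · simp
  have even_no : P.toFrac.step (100 ^ m) (P.runCfg s .even (register a 0 j 0)) =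
        some (P.runCfg (next none) .enter (register a 0 j 0)) := by
    refine step_frac_no (toFrac_instr_inr s .even |>.trans (by
      simp only [runInstr, hs]; rfl)) (by simp) ?_
    have : ¬ 5 ∣ register a 0 j 0 := by rw [five_dvd_register]; omega
    exact this
  -- With c the number of the tail, the stack number is 0 if empty, 2c + 1 for top `a`, and 2(c + 1)
  -- for top `b`. Remainder 1 thus means `a`; for remainder 0 the quotient separates empty from `b`,
  -- and one unit must be taken off the quotient c + 1.
  rcases l with _ | ⟨_ | _, l⟩
  · exact Relation.TransGen.tail' ((enter 0 0 0 (by omega) (by simpa [stackCode] using h)).trans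
      (Reaches.of_step (odd_no 0))) even_no
  · simp only [stackCode, AB.digit, add_zero] at h ⊢
    refine Relation.TransGen.trans_left (Relation.TransGen.tail'
      (enter (stackCode l) 0 1 (by omega) (by omega)) (odd _ (by omega))) ?_
    have := ret .a (0 + stackCode l) 0 (by omega)
    simp only [zero_add] at this ⊢
    exact this
  · simp only [stackCode, AB.digit] at h ⊢
    refine Relation.TransGen.trans_left (Relation.TransGen.tail'
      ((enter (stackCode l + 1) 0 0 (by omega) (by omega)).trans (Reaches.of_step (odd_no _)))
      (even (0 + stackCode l) (by omega))) ?_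
    have := ret .b (0 + stackCode l) 0 (by omega)
    simp only [zero_add] at this ⊢
    exact this

end Instructions

theorem toFrac_simulates (P : StackMachine) (m : ℕ) :
    Simulates (P.step (Fits m)) (P.toFrac.step (100 ^ m)) FracRel := by
  rintro ⟨s, st⟩ d hd c' hc
  simp only [step] at hc
  split_ifs at hc with hok
  rcases hs : P.instr s with ⟨a, x, next⟩ | ⟨a, next⟩ | next | v <;> simp only [hs] at hc
  · cases hc
    rw [fracRel_iff a] at hd
    subst hd
    refine ⟨_, (fracRel_iff a _ _).2 rfl, ?_⟩
    simpa [stackCode] using push_reaches hs ((fits_iff a m st).1 hok)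
  · cases hc
    rw [fracRel_iff a] at hd
    subst hd
    refine ⟨_, (fracRel_iff a _ _).2 rfl, ?_⟩
    simpa using pop_reaches hs (st a) ((fits_iff a m st).1 hok)
  · cases hc
    cases hd
    refine ⟨_, rfl, Reaches₁.of_step ?_⟩
    refine step_frac_yes (toFrac_instr_inr s .enter |>.trans (by
        simp only [runInstr, hs]; rfl)) (by simp) (by simp; rfl) (by simp)
        (register_le_pow ?_)
    have : _ + _ + 1 ≤ m := hok
    simp only at this ⊢
    omega
  · cases hc

theorem toFrac_agrees (P : StackMachine) (m : ℕ) (c : P.Cfg) (d : P.toFrac.State × ℕ)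
    (h : FracRel c d) :
    Agrees (P.step (Fits m)) P.Verdict c (P.toFrac.step (100 ^ m)) P.toFrac.Verdict d := by
  refine (toFrac_simulates P m).agrees ?_ h
  rintro ⟨s, st⟩ d v rfl hv
  refine ⟨_, .refl, ?_⟩
  have hs : P.instr s = .halt v := hv
  simp only [FracMachine.Verdict, runCfg]
  rw [toFrac_instr_inr]
  simp only [runInstr, hs]
  rfl

/-! ### The preparatory phase -/

/-- The counter after `t` divisions. -/
def countAfter (t : ℕ) : Fin 5 :=
  if t < 3 then Fin.ofNat 5 t else if t % 2 = 1 then 3 else 4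

theorem nextCount_countAfter (t : ℕ) : nextCount (countAfter t) = countAfter (t + 1) := by
  rcases lt_or_ge t 3 with h | h
  · interval_cases t <;> decide
  · have h1 : ¬ t < 3 := by omega
    have h2 : ¬ t + 1 < 3 := by omega
    rcases Nat.mod_two_eq_zero_or_one t with h3 | h3
    · have h4 : (t + 1) % 2 = 1 := by omega
      simp [countAfter, h1, h2, h3, h4]; decide
    · have h4 : (t + 1) % 2 = 0 := by omega
      simp [countAfter, h1, h2, h3, h4]; decide

theorem countAfter_eq_three_iff (t : ℕ) : countAfter t = 3 ↔ 3 ≤ t ∧ t % 2 = 1 := by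
  rcases lt_or_ge t 3 with h | h
  · interval_cases t <;> decide
  · have h1 : ¬ t < 3 := by omega
    rcases Nat.mod_two_eq_zero_or_one t with h3 | h3 <;> simp [countAfter, h1, h3, h]

theorem toFrac_instr_inl (p : PrepState) :
    P.toFrac.instr (.inl p : PrepState ⊕ P.State × StackMode) = prepInstr (P.start, .enter) p := rfl

theorem count_div_reaches (n R : ℕ) (hR : ¬ 100 ∣ R) (t u : ℕ) (h : 100 ^ t * R ≤ n) :
    Reaches (P.toFrac.step n) (P.prepCfg (.count (countAfter u)) (100 ^ t * R))
      (P.prepCfg (if countAfter (u + t) = 3 then .notZero else .reject) R) := by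
  induction t generalizing u with
  | zero =>
    refine Reaches.of_step ?_
    rw [pow_zero, one_mul]
    exact step_frac_no (F := P.toFrac) (toFrac_instr_inl _) (by decide) hR
  | succ t ih =>
    have hle : 100 ^ t * R ≤ n := le_trans (Nat.mul_le_mul_right _ (Nat.pow_le_pow_right
      (by norm_num) (Nat.le_succ t))) h
    refine Reaches.cons (b := P.prepCfg (.count (countAfter (u + 1))) (100 ^ t * R)) ?_ ?_
    · rw [← nextCount_countAfter]
      refine step_frac_yes (F := P.toFrac) (W := 100 ^ t * R) (toFrac_instr_inl _) (by decide) ?_ ?_ hle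
      · show _ = 100 * _
        ring
      · simp
    · have := ih (u + 1) hle
      rwa [add_right_comm, add_assoc] at this

theorem start_reaches_count (n : ℕ) (hn : n ≠ 0) :
    Reaches (P.toFrac.step n) (P.toFrac.start, 0) (P.prepCfg (.count (countAfter 0)) n) := by
  obtain ⟨k, rfl⟩ := Nat.exists_eq_succ_of_ne_zero hn
  refine Reaches.cons (b := P.prepCfg .nonzero (k + 1))
    (step_reload (F := P.toFrac) (toFrac_instr_inl .load) 0) ?_
  refine Reaches.cons (b := P.prepCfg .reloadFirst k)
    (step_dec_succ (F := P.toFrac) (toFrac_instr_inl .nonzero) k) ?_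
  exact Reaches.of_step (step_reload (F := P.toFrac) (toFrac_instr_inl .reloadFirst) k)

theorem prep_rejects (n : ℕ) (hn : ∀ m, 3 ≤ m → m % 2 = 1 → n ≠ 100 ^ m) :
    Leads (P.toFrac.step n) (P.toFrac.start, 0) (P.toFrac.Verdict · false) := by
  have reject : ∀ V, P.toFrac.Verdict (P.prepCfg .reject V) false := fun V => rfl
  -- Zero could be divided by 100 forever, so it is sorted out before the divisions.
  rcases eq_or_ne n 0 with rfl | h0
  · refine ⟨_, Reaches.cons (b := P.prepCfg .nonzero 0)
      (step_reload (F := P.toFrac) (toFrac_instr_inl .load) 0) (Reaches.of_step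
      (step_dec_zero (F := P.toFrac) (toFrac_instr_inl .nonzero))), reject 0⟩
  · obtain ⟨t, R, hR, hnR⟩ := Nat.exists_eq_pow_mul_and_not_dvd h0 100 (by norm_num)
    have h1 := start_reaches_count (P := P) n h0
    have h2 := count_div_reaches (P := P) n R hR t 0 hnR.ge
    rw [← hnR, zero_add] at h2
    refine Leads.of_reaches (h1.trans h2) ?_
    split_ifs with h3
    · rw [countAfter_eq_three_iff] at h3
      -- The exponent `t` is admissible, so the cofactor must be at least 2, and both decrements
      -- succeed.
      have hR0 : R ≠ 0 := by rintro rfl; simp at hR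
      obtain ⟨R, rfl⟩ := Nat.exists_eq_succ_of_ne_zero hR0
      have hR1 : R ≠ 0 := by
        rintro rfl
        exact hn t h3.1 h3.2 (by simpa using hnR)
      obtain ⟨R, rfl⟩ := Nat.exists_eq_succ_of_ne_zero hR1
      exact ⟨_, Reaches.cons (b := P.prepCfg .isOne (R + 1))
        (step_dec_succ (F := P.toFrac) (toFrac_instr_inl .notZero) _) (Reaches.of_step
        (step_dec_succ (F := P.toFrac) (toFrac_instr_inl .isOne) _)), reject _⟩
    · exact ⟨_, .refl, reject _⟩

/-- The loop ends exactly at `t = 0`, because 5 divides 100 but no power of 2. -/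
theorem convert_reaches (m t u : ℕ) (h : t + u = m) :
    Reaches (P.toFrac.step (100 ^ m)) (P.prepCfg .convert (100 ^ t * 2 ^ u))
      (P.prepCfg .half (2 ^ m)) := by
  induction t generalizing u with
  | zero =>
    obtain rfl : u = m := by omega
    rw [pow_zero, one_mul]
    refine Reaches.of_step (step_frac_no (F := P.toFrac) (toFrac_instr_inl _) (by decide) ?_)
    show ¬ 100 ∣ 2 ^ u
    intro h100
    have : 5 ∣ 2 ^ u := dvd_trans (by norm_num) h100
    have := Nat.Prime.dvd_of_dvd_pow (by norm_num) this
    norm_num at this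
  | succ t ih =>
    refine Reaches.cons (b := P.prepCfg .convert (100 ^ t * 2 ^ (u + 1))) ?_ (ih _ (by omega))
    refine step_frac_yes (F := P.toFrac) (W := 100 ^ t * 2 ^ u) (toFrac_instr_inl _) (by decide)
      ?_ ?_ ?_
    · show _ = 100 * _
      ring
    · show _ = _ * 2
      ring
    · calc 100 ^ t * 2 ^ (u + 1) ≤ 100 ^ t * 100 ^ (u + 1) := by gcongr; norm_num
        _ = 100 ^ m := by rw [← pow_add]; congr 1; omega

theorem prep_reaches (m : ℕ) (h3 : 3 ≤ m) (hodd : m % 2 = 1) :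
    Reaches (P.toFrac.step (100 ^ m)) (P.toFrac.start, 0)
      (P.runCfg P.start .enter (register false (m - 1) 0 0)) := by
  have h1 := start_reaches_count (P := P) (100 ^ m) (by positivity)
  have h2 := count_div_reaches (P := P) (100 ^ m) 1 (by norm_num) m 0 (by simp)
  rw [zero_add, if_pos ((countAfter_eq_three_iff m).2 ⟨h3, hodd⟩), mul_one] at h2
  refine (h1.trans h2).trans ?_
  refine Reaches.cons (b := P.prepCfg .isOne 0)
    (step_dec_succ (F := P.toFrac) (toFrac_instr_inl .notZero) 0) ?_
  refine Reaches.cons (b := P.prepCfg .reloadSecond 0)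
    (step_dec_zero (F := P.toFrac) (toFrac_instr_inl .isOne)) ?_
  refine Reaches.cons (b := P.prepCfg .convert (100 ^ m))
    (step_reload (F := P.toFrac) (toFrac_instr_inl .reloadSecond) 0) ?_
  have h4 := convert_reaches (P := P) m m 0 (by omega)
  rw [pow_zero, mul_one] at h4
  refine h4.trans (Reaches.of_step ?_)
  refine step_frac_yes (F := P.toFrac) (W := 2 ^ (m - 1)) (toFrac_instr_inl _) (by decide) ?_ ?_
    (register_le_pow (by omega))
  · show _ = 2 * _
    rw [← pow_succ']
    congr 1
    omega
  · simp [register, stackPrime]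

end StackMachine

/-! ### Keeping the bottoms of the stacks in the finite control -/

/-- A buffer for the lowest symbols of a stack. -/
abbrev StackBuffer := {b : List AB // b.length ≤ 3}

instance : Finite StackBuffer := (List.finite_length_le AB 3).to_subtype

namespace StackBuffer

/-- The empty buffer. -/
def empty : StackBuffer := ⟨[], by simp⟩

/-- Remove the top symbol. -/
def tail (b : StackBuffer) : StackBuffer := ⟨b.1.tail, by have := b.2; simp; omega⟩

/-- Add a symbol on top. -/
def cons (x : AB) (b : StackBuffer) (h : b.1.length < 3) : StackBuffer := ⟨x :: b.1, h⟩

end StackBuffer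

/-- The states of the machine that keeps the bottoms of the stacks of a machine with the states `S`
in its control: it first moves the left stack, without its top symbol, to the right stack. -/
inductive BufferedState (S : Type)
  | drop
  | fetch (b : StackBuffer)
  | store (b : StackBuffer) (x : AB)
  | main (s : S) (b : Bool → StackBuffer)

namespace BufferedState

/-- An injective code. -/
def toSum {S : Type} :
    BufferedState S → Unit ⊕ StackBuffer ⊕ (StackBuffer × AB) ⊕ (S × (Bool → StackBuffer))
  | drop => .inl ()
  | fetch b => .inr (.inl b)
  | store b x => .inr (.inr (.inl (b, x)))
  | main s b => .inr (.inr (.inr (s, b)))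

instance {S : Type} [Finite S] : Finite (BufferedState S) :=
  Finite.of_injective toSum (by intro x y h; cases x <;> cases y <;> simp_all [toSum])

end BufferedState

namespace StackMachine

open StateTransition

/-- The two stacks as a function. -/
def twoStacks (l r : List AB) : Bool → List AB
  | false => l
  | true => r

@[simp]
theorem update_twoStacks_false (l r l' : List AB) :
    Function.update (twoStacks l r) false l' = twoStacks l' r := by
  funext s; cases s <;> rfl

@[simp]
theorem update_twoStacks_true (l r r' : List AB) :
    Function.update (twoStacks l r) true r' = twoStacks l r' := by
  funext s; cases s <;> rfl

/-- The instructions of the machine that keeps the bottoms of the stacks of `Q` in its control. -/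
def bufferedInstr (Q : StackMachine) : BufferedState Q.State → StackInstr (BufferedState Q.State)
  | .drop => .pop false fun _ => .fetch .empty
  | .fetch b => .pop false fun
    | some x => .store b x
    | none => .main Q.start fun s => if s then b else .empty
  | .store b x =>
    if h : b.1.length < 3 then .nop (.fetch (b.cons x h)) else .push true x (.fetch b)
  | .main s b =>
    match Q.instr s with
    | .push a x next =>
      if h : (b a).1.length < 3 then .nop (.main next (Function.update b a ((b a).cons x h)))
      else .push a x (.main next b)
    | .pop a next => .pop a fun
      | some x => .main (next (some x)) b
      | none => .main (next (b a).1.head?) (Function.update b a (b a).tail)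
    | .nop next => .nop (.main next b)
    | .halt v => .halt v

/-- The machine that keeps the bottoms of the stacks of `Q` in its control. -/
def buffered (Q : StackMachine) : StackMachine where
  State := BufferedState Q.State
  finite_state := by
    have := Q.finite_state
    infer_instance
  start := .drop
  instr := Q.bufferedInstr

/-- No stack is higher than `k`. -/
def HeightLE (k : ℕ) (st : Bool → List AB) : Prop := ∀ a, (st a).length ≤ k

/-- The list `l` is split into the stack `t` and the buffer `b`. -/
def Split (l t : List AB) (b : StackBuffer) : Prop := l = t ++ b.1 ∧ (t = [] ∨ b.1.length = 3)

theorem Split.push_buffer {l t : List AB} {b : StackBuffer} (h : Split l t b) (x : AB)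
    (hb : b.1.length < 3) : Split (x :: l) t (b.cons x hb) := by
  obtain ⟨rfl, rfl | h2⟩ := h
  · exact ⟨by simp [StackBuffer.cons], .inl rfl⟩
  · omega

theorem Split.push_stack {l t : List AB} {b : StackBuffer} (h : Split l t b) (x : AB)
    (hb : ¬ b.1.length < 3) : Split (x :: l) (x :: t) b := by
  obtain ⟨rfl, h2⟩ := h
  have := b.2
  exact ⟨by simp, .inr (by omega)⟩

/-- A nonempty `t` sits on a full buffer of three letters, so its height is at most k - 1. -/
theorem Split.stackCode_lt {l t : List AB} {b : StackBuffer} (h : Split l t b) {k : ℕ}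
    (hl : l.length ≤ k + 2) : stackCode t + 1 ≤ 2 ^ k := by
  obtain ⟨rfl, rfl | h2⟩ := h
  · simpa [stackCode] using Nat.one_le_two_pow
  · have h3 := stackCode_add_two_le t
    have h4 : t.length + 1 ≤ k := by simp at hl; omega
    have := Nat.pow_le_pow_right (n := 2) (by norm_num) h4
    omega

variable {Q : StackMachine} {k m : ℕ}

/-- The stacks of `Q` are split into those of the buffered machine and the buffers. -/
def BufferedRel (c : Q.Cfg) (d : Q.buffered.Cfg) : Prop :=
  ∃ b : Bool → StackBuffer, d.1 = BufferedState.main c.1 b ∧ ∀ a, Split (c.2 a) (d.2 a) (b a)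

theorem fits_of_split {st st' : Bool → List AB} {b : Bool → StackBuffer}
    (h : ∀ a, Split (st a) (st' a) (b a)) (hk : HeightLE (k + 2) st) (hm : 2 ^ (k + 1) ≤ m) :
    Fits m st' := by
  have h1 := (h false).stackCode_lt (hk false)
  have h2 := (h true).stackCode_lt (hk true)
  rw [pow_succ] at hm
  unfold Fits
  omega

/-- Letters lie on the stack only above a full buffer. So the fill level of the buffer decides where
a push goes, and a pop turns to the buffer only when the stack is found empty. -/
theorem buffered_simulates (Q : StackMachine) (hm : 2 ^ (k + 1) ≤ m) :
    Simulates (Q.step (HeightLE (k + 2))) (Q.buffered.step (Fits m)) BufferedRel := by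
  rintro ⟨s, st⟩ ⟨_, st'⟩ ⟨b, rfl, hsplit⟩ c' hc
  simp only [step] at hc
  split_ifs at hc with hok
  have hfit : Fits m st' := fits_of_split hsplit hok hm
  have hinstr : Q.buffered.instr (BufferedState.main s b) = Q.bufferedInstr (.main s b) := rfl
  rcases hs : Q.instr s with ⟨a, x, next⟩ | ⟨a, next⟩ | next | v <;> simp only [hs] at hc
  · cases hc
    by_cases hb : (b a).1.length < 3
    · refine ⟨(BufferedState.main next (Function.update b a ((b a).cons x hb)), st'), ⟨_, rfl, ?_⟩,
        Reaches₁.of_step ?_⟩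
      · intro a'
        rcases eq_or_ne a' a with rfl | h
        · simpa using (hsplit a').push_buffer x hb
        · simpa [Function.update_of_ne h] using hsplit a'
      · simp only [step, if_pos hfit]
        rw [hinstr]
        simp only [bufferedInstr, hs, dif_pos hb]
    · refine ⟨(BufferedState.main next b, Function.update st' a (x :: st' a)), ⟨_, rfl, ?_⟩,
        Reaches₁.of_step ?_⟩
      · intro a'
        rcases eq_or_ne a' a with rfl | h
        · simpa using (hsplit a').push_stack x hb
        · simpa [Function.update_of_ne h] using hsplit a'
      · simp only [step, if_pos hfit]
        rw [hinstr]
        simp only [bufferedInstr, hs, dif_neg hb]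
  · cases hc
    obtain ⟨h1, h2⟩ := hsplit a
    dsimp only at h1 h2
    rcases ht : st' a with _ | ⟨x, t⟩
    · refine ⟨(BufferedState.main (next (b a).1.head?) (Function.update b a (b a).tail), st'),
        ⟨Function.update b a (b a).tail, ?_, ?_⟩, Reaches₁.of_step ?_⟩
      · simp [h1, ht]; rfl
      · intro a'
        rcases eq_or_ne a' a with rfl | h
        · simp [h1, ht, Split, StackBuffer.tail]
        · simpa [Function.update_of_ne h] using hsplit a'
      · simp only [step, if_pos hfit]
        rw [hinstr]
        simp only [bufferedInstr, hs, ht]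
        simp
        rw [← ht, Function.update_eq_self]
    · refine ⟨(BufferedState.main (next (some x)) b, Function.update st' a t),
        ⟨b, ?_, ?_⟩, Reaches₁.of_step ?_⟩
      · simp [h1, ht]; rfl
      · intro a'
        rcases eq_or_ne a' a with rfl | h
        · have h3 : (b a').1.length = 3 := by simpa [ht] using h2
          simp [h1, ht, Split, h3]
        · simpa [Function.update_of_ne h] using hsplit a'
      · simp only [step, if_pos hfit]
        rw [hinstr]
        simp only [bufferedInstr, hs, ht]
        simp
  · cases hc
    refine ⟨(BufferedState.main next b, st'), ⟨_, rfl, hsplit⟩, Reaches₁.of_step ?_⟩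
    simp only [step, if_pos hfit]
    rw [hinstr]
    simp only [bufferedInstr, hs]
  · cases hc

/-- Here `w` is the part already moved, held as `t` above `b`. The first letters moved become the
bottom of the new stack, so they enter the buffer directly. -/
theorem fetch_reaches (hm : 2 ^ (k + 1) ≤ m) (l w t : List AB) (b : StackBuffer)
    (hsplit : Split w t b) (hlen : l.length + w.length ≤ k) :
    ∃ d, BufferedRel (Q.start, twoStacks [] (l.reverse ++ w)) d ∧
      Reaches (Q.buffered.step (Fits m)) (BufferedState.fetch b, twoStacks l t) d := by
  have hfit : ∀ (l w t : List AB) (b : StackBuffer), Split w t b → l.length + w.length ≤ k →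
      Fits m (twoStacks l t) := by
    rintro l w t b ⟨rfl, h⟩ hlen
    have h1 := stackCode_add_two_le l
    have h2 := stackCode_add_two_le t
    rw [pow_succ] at hm h1 h2
    have hp : ∀ i, i ≤ k → 2 ^ i ≤ 2 ^ k := fun i hi => Nat.pow_le_pow_right (by norm_num) hi
    simp only [Fits, twoStacks]
    -- Either the right stack is empty and `l` has all the room, or three letters are in the buffer
    -- and both heights are below `k`.
    rcases h with rfl | h
    · have := hp l.length (by simp at hlen; omega)
      simp only [stackCode]
      omega
    · simp at hlen
      have h3 := hp (l.length + 1) (by omega)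
      have h4 := hp (t.length + 1) (by omega)
      rw [pow_succ] at h3 h4
      omega
  induction l generalizing w t b with
  | nil =>
    refine ⟨(BufferedState.main Q.start fun s => if s then b else .empty, twoStacks [] t),
      ⟨_, rfl, ?_⟩, Reaches.of_step ?_⟩
    · intro a
      cases a
      · simp [twoStacks, Split, StackBuffer.empty]
      · simpa [twoStacks] using hsplit
    · simp only [step, if_pos (hfit [] w t b hsplit hlen)]
      simp [buffered, bufferedInstr, twoStacks]
  | cons x l ih =>
    have hlen' : l.length + (x :: w).length ≤ k := by simp at hlen ⊢; omega
    have hlen'' : l.length + w.length ≤ k := by simp at hlen ⊢; omega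
    have fetch : Q.buffered.step (Fits m) (BufferedState.fetch b, twoStacks (x :: l) t) =
        some (BufferedState.store b x, twoStacks l t) := by
      simp only [step, if_pos (hfit (x :: l) w t b hsplit hlen)]
      simp [buffered, bufferedInstr]
      simp [twoStacks]
    have hfit' := hfit l w t b hsplit hlen''
    by_cases hb : b.1.length < 3
    · obtain ⟨d, hd, hr⟩ := ih (x :: w) t (b.cons x hb) (hsplit.push_buffer x hb) hlen'
      refine ⟨d, by simpa using hd, Reaches.cons fetch (Reaches.cons ?_ hr)⟩
      simp only [step, if_pos hfit']
      simp [buffered, bufferedInstr, hb]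
    · obtain ⟨d, hd, hr⟩ := ih (x :: w) (x :: t) b (hsplit.push_stack x hb) hlen'
      refine ⟨d, by simpa using hd, Reaches.cons fetch (Reaches.cons ?_ hr)⟩
      simp only [step, if_pos hfit']
      simp [buffered, bufferedInstr, hb]
      simp [twoStacks]

/-- The top `b` is the closing digit of 1w1 and is dropped; moving the rest turns `w.reverse` on the
left into `w` on the right. The initial stack meets `Fits m` with equality. -/
theorem buffered_agrees (Q : StackMachine) (w : List AB)
    (hm : m = stackCode (.b :: w.reverse) + 1) :
    Agrees (Q.step (HeightLE (w.length + 2))) Q.Verdict (Q.start, twoStacks [] w)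
      (Q.buffered.step (Fits m)) Q.buffered.Verdict
      (Q.buffered.start, twoStacks (.b :: w.reverse) []) := by
  have hm' : 2 ^ (w.length + 1) ≤ m := by
    rw [hm]
    simpa using two_pow_length_le (.b :: w.reverse)
  have drop : Q.buffered.step (Fits m) (Q.buffered.start, twoStacks (.b :: w.reverse) []) =
      some (BufferedState.fetch .empty, twoStacks w.reverse []) := by
    have : Fits m (twoStacks (.b :: w.reverse) []) := by
      rw [hm]
      simp [Fits, twoStacks, stackCode]
    simp only [step, if_pos this]
    simp [buffered, bufferedInstr]
    simp [twoStacks]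
  obtain ⟨d, hd, hr⟩ := fetch_reaches (Q := Q) hm' w.reverse [] [] .empty
    ⟨by simp [StackBuffer.empty], .inl rfl⟩ (by simp)
  simp only [List.reverse_reverse, List.append_nil] at hd
  refine Agrees.of_reaches (Reaches.cons drop hr) ((buffered_simulates Q hm').agrees ?_ hd)
  rintro ⟨s, st⟩ ⟨_, st'⟩ v ⟨b, rfl, -⟩ hv
  have hs : Q.instr s = .halt v := hv
  exact ⟨_, .refl, by simp [Verdict, buffered, bufferedInstr, hs]⟩

end StackMachine

/-! ### Turing machines with a single block -/

namespace BinaryDTM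

open StateTransition

variable {M : BinaryDTM}

/-- The direction of a half of the tape: `false` is the left one. -/
def sgn : Bool → ℤ
  | false => -1
  | true => 1

theorem sgn_not (s : Bool) : sgn (!s) = -sgn s := by cases s <;> rfl

theorem sgn_mul_self (s : Bool) : sgn s * sgn s = 1 := by cases s <;> rfl

theorem sgn_eq (s : Bool) : sgn s = 1 ∨ sgn s = -1 := by cases s <;> simp [sgn]

theorem shift_bound (m : HeadMove) : -1 ≤ m.shift ∧ m.shift ≤ 1 := by
  cases m <;> simp [HeadMove.shift]

/-- The state is accepting or rejecting. -/
def Halting (M : BinaryDTM) (q : M.State) : Prop := q = M.accept ∨ q = M.reject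

theorem step_of_not_halting {c : M.Cfg} (h : ¬ M.Halting c.state) :
    M.step c = some ⟨(M.δ c.state (c.tape c.pos)).1,
      c.pos + (M.δ c.state (c.tape c.pos)).2.2.shift,
      Function.update c.tape c.pos (M.δ c.state (c.tape c.pos)).2.1⟩ := by
  rw [step, if_neg (by exact h)]

theorem step_eq_some {c c' : M.Cfg} (h : M.step c = some c') :
    ¬ M.Halting c.state ∧ c' = ⟨(M.δ c.state (c.tape c.pos)).1,
      c.pos + (M.δ c.state (c.tape c.pos)).2.2.shift,
      Function.update c.tape c.pos (M.δ c.state (c.tape c.pos)).2.1⟩ := by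
  by_cases hh : M.Halting c.state
  · rw [step, if_pos (by exact hh)] at h
    cases h
  · rw [step_of_not_halting hh] at h
    exact ⟨hh, (Option.some.inj h).symm⟩

theorem Reachable.next {w : List AB} {c c' : M.Cfg} (h : M.Reachable w c)
    (hs : M.step c = some c') : M.Reachable w c' :=
  Relation.ReflTransGen.tail h hs

theorem inputTape_ne_none {w : List AB} {i : ℤ} (h : inputTape w i ≠ none) :
    1 ≤ i ∧ i ≤ w.length := by
  unfold inputTape at h
  split_ifs at h with h0
  · simp at h
  · have : (i - 1).toNat < w.length := by
      by_contra h1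
      exact h (List.getElem?_eq_none (by omega))
    omega

theorem Reachable.nonblank_bounds (hspace : M.InputSpace) {w : List AB} {c : M.Cfg}
    (h : M.Reachable w c) {i : ℤ} (hi : c.tape i ≠ none) : 0 ≤ i ∧ i ≤ w.length + 1 := by
  induction h generalizing i with
  | refl =>
    have := inputTape_ne_none hi
    omega
  | @tail c d hc hd ih =>
    obtain ⟨-, rfl⟩ := step_eq_some hd
    rcases eq_or_ne i c.pos with rfl | hne
    · exact hspace w c hc
    · dsimp only at hi
      rw [Function.update_of_ne hne] at hi
      exact ih hi

/-- Squares beyond a gap that follows the block are blank. -/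
theorem blank_beyond {t : ℤ → Option AB} (ht : {i | t i ≠ none}.OrdConnected) (s : Bool) (i d e : ℤ)
    (hi : t i ≠ none) (hd : 0 ≤ d) (hde : d ≤ e) (hb : t (i + sgn s * d) = none) :
    t (i + sgn s * e) = none := by
  by_contra he
  rcases sgn_eq s with hs | hs
  · exact ht.out hi he (show i + sgn s * d ∈ Set.Icc i (i + sgn s * e) by
      rw [hs]; exact ⟨by omega, by omega⟩) hb
  · exact ht.out he hi (show i + sgn s * d ∈ Set.Icc (i + sgn s * e) i by
      rw [hs]; exact ⟨by omega, by omega⟩) hb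

/-! ### Bounding the distance between the head and the block -/

/-- The walk on a blank half-line, extending in the direction `s`, that starts in the state `q₀` at
its first square.  It ends when the half-line is left. -/
inductive BlankWalk (M : BinaryDTM) (s : Bool) (q₀ : M.State) : M.State → ℤ → Prop
  | start : BlankWalk M s q₀ q₀ 0
  | step {q o} : BlankWalk M s q₀ q o → 0 ≤ o → ¬ M.Halting q →
      BlankWalk M s q₀ (M.δ q none).1 (o + sgn s * (M.δ q none).2.2.shift)

/-- Walks on a blank half-line from the state `q₀` stay within the distance `B`. -/
def WalkBound (M : BinaryDTM) (s : Bool) (q₀ : M.State) (B : ℤ) : Prop :=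
  ∀ q o, BlankWalk M s q₀ q o → o ≤ B

/-- There is a common bound for all states and directions from which the walks are bounded. -/
theorem exists_walkBound (M : BinaryDTM) :
    ∃ G : ℕ, ∀ s q₀, (∃ B, M.WalkBound s q₀ B) → M.WalkBound s q₀ G := by
  classical
  have := M.finite_state
  have := Fintype.ofFinite M.State
  let f : Bool × M.State → ℕ := fun x =>
    if h : ∃ B, M.WalkBound x.1 x.2 B then h.choose.toNat else 0
  refine ⟨Finset.univ.sup f, fun s q₀ h q o ho => ?_⟩
  have h1 : f (s, q₀) ≤ Finset.univ.sup f := Finset.le_sup (Finset.mem_univ _)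
  have h2 : f (s, q₀) = h.choose.toNat := by simp only [f]; rw [dif_pos h]
  have h3 := h.choose_spec q o ho
  omega

/-- A walk that leaves the block at the side `s` of the block is realized by the machine. -/
theorem Reachable.blankWalk (hblock : M.SingleBlock) {w : List AB} {c : M.Cfg}
    (hc : M.Reachable w c) (s : Bool) (h2 : c.tape (c.pos - sgn s * 2) ≠ none)
    (h1 : c.tape (c.pos - sgn s) = none) {q : M.State} {o : ℤ} (h : M.BlankWalk s c.state q o) :
    M.Reachable w ⟨q, c.pos + sgn s * o, c.tape⟩ := by
  induction h with
  | start => simpa using hc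
  | @step q o _ ho hq ih =>
    have hblank : c.tape (c.pos + sgn s * o) = none := by
      have := blank_beyond (hblock w c hc) s (c.pos - sgn s * 2) 1 (o + 2) h2 (by omega) (by omega)
        (by convert h1 using 2; ring)
      convert this using 2; ring
    have hstep := step_of_not_halting (c := ⟨q, c.pos + sgn s * o, c.tape⟩) hq
    simp only [hblank] at hstep
    have hnext := ih.next hstep
    have hne : ∀ d : ℤ, 0 < d → c.pos - sgn s * d ≠ c.pos + sgn s * o := by
      intro d hd heq
      rcases sgn_eq s with hs | hs <;> rw [hs] at heq <;> omega
    -- A letter written here would be cut off from the block by the blank at `c.pos - sgn s`.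
    have hwrite : (M.δ q none).2.1 = none := by
      by_contra hy
      have := blank_beyond (hblock w _ hnext) s (c.pos - sgn s * 2) 1 (o + 2)
        (by simpa only [Function.update_of_ne (hne 2 (by omega))] using h2) (by omega) (by omega)
        (by
          have : c.pos - sgn s * 2 + sgn s * 1 = c.pos - sgn s * 1 := by ring
          rw [this]
          simp only [Function.update_of_ne (hne 1 (by omega))]
          simpa using h1)
      have e : c.pos - sgn s * 2 + sgn s * (o + 2) = c.pos + sgn s * o := by ring
      rw [e] at this
      simp only [Function.update_self] at this
      exact hy this
    have htape : Function.update c.tape (c.pos + sgn s * o) (M.δ q none).2.1 = c.tape := by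
      rw [hwrite, ← hblank, Function.update_eq_self]
    rw [htape] at hnext
    convert hnext using 2
    rw [mul_add, ← mul_assoc, sgn_mul_self, one_mul, add_assoc]

/-- The head is on a bounded blank walk whenever it is away from the block. -/
theorem Reachable.exists_walk (hblock : M.SingleBlock) (hspace : M.InputSpace) {w : List AB}
    {c : M.Cfg} (hc : M.Reachable w c) (s : Bool) (d : ℤ) (hd : 2 ≤ d)
    (hn : c.tape (c.pos - sgn s * d) ≠ none) (hb : c.tape (c.pos - sgn s * (d - 1)) = none) :
    ∃ q₀, (∃ B, M.WalkBound s q₀ B) ∧ M.BlankWalk s q₀ c.state (d - 2) := by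
  -- The machine really performs the walk, so the space bound for this `w` limits it. Only the
  -- existence of a bound matters here; `exists_walkBound` makes it uniform.
  have enter : ∀ c, M.Reachable w c → c.tape (c.pos - sgn s * 2) ≠ none →
      c.tape (c.pos - sgn s) = none → ∃ B, M.WalkBound s c.state B := by
    intro c hc h2 h1
    refine ⟨w.length + 1, fun q o ho => ?_⟩
    have h3 := hspace w _ (hc.blankWalk hblock s h2 h1 ho)
    have h4 := hspace w c hc
    simp only at h3
    rcases sgn_eq s with hs | hs <;> rw [hs] at h3 <;> omega
  induction hc generalizing d with
  | refl =>
    obtain ⟨h1, h2⟩ := inputTape_ne_none hn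
    exfalso
    have hb' : inputTape w (w.length + 1 - sgn s * (d - 1)) = none := hb
    simp only [init] at h1 h2
    rcases sgn_eq s with hs | hs <;> rw [hs] at h1 h2 hb'
    · have h3 : ¬ ((w.length : ℤ) + 1 - 1 * (d - 1) ≤ 0) := by omega
      rw [inputTape, if_neg h3, List.getElem?_eq_none_iff] at hb'
      omega
    · omega
  | @tail c c' hc hcc' ih =>
    obtain ⟨hh, rfl⟩ := step_eq_some hcc'
    have hc' := Reachable.next hc hcc'
    set δ := M.δ c.state (c.tape c.pos) with hδ
    obtain ⟨hm1, hm2⟩ := shift_bound δ.2.2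
    dsimp only at hn hb
    -- The distance to the same square before the step. If it is at least 2, the earlier walk
    -- continues; otherwise `e = 1` and `d = 2`, and a new walk starts.
    set e : ℤ := d - sgn s * δ.2.2.shift with he
    have e1 : c.pos + δ.2.2.shift - sgn s * d = c.pos - sgn s * e := by
      rw [he, mul_sub, ← mul_assoc, sgn_mul_self]; ring
    have e2 : c.pos + δ.2.2.shift - sgn s * (d - 1) = c.pos - sgn s * (e - 1) := by
      rw [he, mul_sub, mul_sub, mul_sub, ← mul_assoc, sgn_mul_self]; ring
    have hed : d - 1 ≤ e := by
      rcases sgn_eq s with hs | hs <;> rw [he, hs] <;> omega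
    rcases le_or_gt 2 e with h2 | h2
    · have hne : ∀ x : ℤ, 1 ≤ x → c.pos - sgn s * x ≠ c.pos := by
        intro x hx h
        rcases sgn_eq s with hs | hs <;> rw [hs] at h <;> omega
      rw [e1, Function.update_of_ne (hne e (by omega))] at hn
      rw [e2, Function.update_of_ne (hne (e - 1) (by omega))] at hb
      obtain ⟨q₀, hB, hw⟩ := ih e h2 hn hb
      refine ⟨q₀, hB, ?_⟩
      have hblank : c.tape c.pos = none := by
        have := blank_beyond (hblock w c hc) s (c.pos - sgn s * e) 1 e hn (by omega) (by omega)
          (by convert hb using 2; ring)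
        convert this using 2; ring
      have := hw.step (by omega) hh
      rw [← hblank, ← hδ] at this
      convert this using 1
      rw [he]; ring
    · obtain rfl : d = 2 := by omega
      refine ⟨_, enter _ hc' hn (by simpa using hb), ?_⟩
      exact BlankWalk.start

/-- The distance of the head from the block is bounded independently of the input. -/
theorem exists_gap_bound (hblock : M.SingleBlock) (hspace : M.InputSpace) :
    ∃ G : ℕ, ∀ w c, M.Reachable w c → ∀ (s : Bool) (d : ℤ), c.tape (c.pos - sgn s * d) ≠ none →
      c.tape (c.pos - sgn s * (d - 1)) = none → d ≤ G := by
  obtain ⟨G, hG⟩ := M.exists_walkBound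
  -- Offset 0 of a walk is distance 2 from the block: a letter at distance 1 would merely extend the
  -- block.
  refine ⟨G + 2, fun w c hc s d hn hb => ?_⟩
  push_cast
  rcases le_or_gt 2 d with hd | hd
  · obtain ⟨q₀, hB, hw⟩ := hc.exists_walk hblock hspace s d hd hn hb
    have := hG s q₀ hB _ _ hw
    omega
  · omega

end BinaryDTM

/-! ### Simulation of a Turing machine with a single block by a stack machine -/

/-- The states of the stack machine that simulates a Turing machine with the states `S`.  Between
the head and the stack on each side there is a gap of at most `G` blanks. -/
inductive TapeState (S : Type) (G : ℕ)
  | unload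
  | load (x : AB)
  | main (q : S) (gap : Bool → Fin (G + 1)) (x : Option AB)
  /-- the symbol under the head has to be fetched from the side `s` -/
  | fetch (q : S) (gap : Bool → Fin (G + 1)) (s : Bool)

namespace TapeState

/-- An injective code. -/
def toSum {S : Type} {G : ℕ} : TapeState S G →
    Unit ⊕ AB ⊕ (S × (Bool → Fin (G + 1)) × Option AB) ⊕ (S × (Bool → Fin (G + 1)) × Bool)
  | unload => .inl ()
  | load x => .inr (.inl x)
  | main q gap x => .inr (.inr (.inl (q, gap, x)))
  | fetch q gap s => .inr (.inr (.inr (q, gap, s)))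

instance {S : Type} {G : ℕ} [Finite S] : Finite (TapeState S G) :=
  Finite.of_injective toSum (by intro x y h; cases x <;> cases y <;> simp_all [toSum])

end TapeState

namespace BinaryDTM

open StateTransition StackMachine

variable {M : BinaryDTM} {G : ℕ}

/-- One more blank in a gap, up to the maximum. -/
def gapSucc (g : Fin (G + 1)) : Fin (G + 1) := ⟨min (g.val + 1) G, by omega⟩

/-- One blank less in a gap. -/
def gapPred (g : Fin (G + 1)) : Fin (G + 1) := ⟨g.val - 1, by omega⟩

/-- The instruction for writing `y` and moving to the side `s`. -/
def leaveInstr {S : Type} (q : S) (gap : Bool → Fin (G + 1)) (s : Bool) :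
    Option AB → StackInstr (TapeState S G)
  | some y => .push (!s) y (.fetch q (Function.update gap (!s) 0) s)
  | none => .nop (.fetch q (Function.update gap (!s) (gapSucc (gap !s))) s)

open Classical in
/-- The instructions of the stack machine that simulates `M`. -/
noncomputable def tapeInstr (M : BinaryDTM) (G : ℕ) :
    TapeState M.State G → StackInstr (TapeState M.State G)
  | .unload => .pop true fun
    | some x => .load x
    | none => .main M.start 0 none
  | .load x => .push false x .unload
  | .main q gap x =>
    if q = M.accept then .halt true
    else if q = M.reject then .halt false
    else
      match (M.δ q x).2.2 with
      | .stay => .nop (.main (M.δ q x).1 gap (M.δ q x).2.1)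
      | .left => leaveInstr (M.δ q x).1 gap false (M.δ q x).2.1
      | .right => leaveInstr (M.δ q x).1 gap true (M.δ q x).2.1
  | .fetch q gap s =>
    if gap s = 0 then .pop s (.main q gap)
    else .nop (.main q (Function.update gap s (gapPred (gap s))) none)

/-- The stack machine that simulates `M`. -/
noncomputable def toStack (M : BinaryDTM) (G : ℕ) : StackMachine where
  State := TapeState M.State G
  finite_state := by
    have := M.finite_state
    infer_instance
  start := .unload
  instr := M.tapeInstr G

/-- A configuration of the stack machine that simulates `M`. -/
def tapeCfg (s : TapeState M.State G) (st : Bool → List AB) : (M.toStack G).Cfg := (s, st)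

theorem toStack_instr (s : TapeState M.State G) : (M.toStack G).instr s = M.tapeInstr G s := rfl

/-- The squares of a half-tape on which a gap of length `g` is followed by `l` and by blanks. -/
def halfCell (g : ℕ) (l : List AB) (k : ℕ) : Option AB := if k < g then none else l[k - g]?

theorem halfCell_nil (g k : ℕ) : halfCell g [] k = none := by simp [halfCell]

theorem halfCell_gap_succ_zero (g : ℕ) (l : List AB) : halfCell (g + 1) l 0 = none := by
  simp [halfCell]

theorem halfCell_gap_succ (g : ℕ) (l : List AB) (k : ℕ) :
    halfCell (g + 1) l (k + 1) = halfCell g l k := by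
  simp [halfCell]

theorem halfCell_no_gap (l : List AB) : halfCell 0 l 0 = l.head? := by
  cases l <;> simp [halfCell]

theorem halfCell_no_gap_succ (l : List AB) (k : ℕ) : halfCell 0 l (k + 1) = halfCell 0 l.tail k := by
  cases l <;> simp [halfCell]

theorem halfCell_ne_none (g : ℕ) {l : List AB} (h : l ≠ []) : halfCell g l g ≠ none := by
  cases l <;> simp_all [halfCell]

theorem halfCell_last_ne_none (g : ℕ) {l : List AB} (h : l ≠ []) :
    halfCell g l (g + l.length - 1) ≠ none := by
  have := List.length_pos_of_ne_nil h
  have h1 : ¬ g + l.length - 1 < g := by omega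
  rw [halfCell, if_neg h1, ne_eq, List.getElem?_eq_none_iff]
  omega

/-- The squares of a half-tape on which `y` is followed by the squares of `h`. -/
def consCell (y : Option AB) (h : ℕ → Option AB) : ℕ → Option AB
  | 0 => y
  | k + 1 => h k

theorem bool_eq_or_eq_not (a s : Bool) : a = s ∨ a = !s := by
  cases a <;> cases s <;> simp

theorem fetch_step (ok : (Bool → List AB) → Prop) (q : M.State) (gap : Bool → Fin (G + 1))
    (s : Bool) (st : Bool → List AB) (hok : ok st) :
    ∃ gap' st', (M.toStack G).step ok (tapeCfg (.fetch q gap s) st) =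
        some (tapeCfg (.main q gap' (halfCell (gap s) (st s) 0)) st') ∧
      (∀ k, halfCell (gap' s) (st' s) k = halfCell (gap s) (st s) (k + 1)) ∧
      gap' (!s) = gap (!s) ∧ st' (!s) = st (!s) := by
  have hns : (!s) ≠ s := by cases s <;> simp
  by_cases h : gap s = 0
  · refine ⟨gap, Function.update st s (st s).tail, ?_, ?_, rfl, Function.update_of_ne hns _ _⟩
    · rw [StackMachine.step, if_pos (by exact hok)]
      simp only [tapeCfg]
      rw [toStack_instr]
      simp only [tapeInstr, h, if_true, Fin.val_zero, halfCell_no_gap]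
    · intro k
      simp [h, halfCell_no_gap_succ]
  · have hg : (gap s).val = (gap s).val - 1 + 1 := by
      have : (gap s).val ≠ 0 := fun h0 => h (Fin.ext h0)
      omega
    refine ⟨Function.update gap s (gapPred (gap s)), st, ?_, ?_, Function.update_of_ne hns _ _, rfl⟩
    · rw [StackMachine.step, if_pos (by exact hok)]
      simp only [tapeCfg]
      rw [toStack_instr, hg, halfCell_gap_succ_zero]
      simp only [tapeInstr, h, if_false]
    · intro k
      rw [hg, halfCell_gap_succ, Function.update_self, gapPred]

/-- The hypotheses `hgap` and `hy` exclude what cannot be represented: an overflowing gap, and a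
letter separated by blanks from the stack. Over an empty stack the gap has no meaning and may
saturate. -/
theorem leave_step (q : M.State) (gap : Bool → Fin (G + 1)) (s : Bool) (y : Option AB)
    (st : Bool → List AB) (hgap : y = none → st (!s) = [] ∨ (gap !s).val + 1 ≤ G)
    (hy : y ≠ none → st (!s) = [] ∨ (gap !s).val = 0) {b : ℕ} (hst : HeightLE b st) :
    ∃ gap' st', (∀ (ok : (Bool → List AB) → Prop) (t : TapeState M.State G), ok st →
        (M.toStack G).instr t = leaveInstr q gap s y →
        (M.toStack G).step ok (tapeCfg t st) = some (tapeCfg (.fetch q gap' s) st')) ∧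
      (∀ k, halfCell (gap' !s) (st' !s) k = consCell y (halfCell (gap !s) (st !s)) k) ∧
      gap' s = gap s ∧ st' s = st s ∧ HeightLE (b + 1) st' := by
  have hns : s ≠ (!s) := by cases s <;> simp
  rcases y with _ | y
  · refine ⟨Function.update gap (!s) (gapSucc (gap !s)), st, ?_, ?_, Function.update_of_ne hns _ _,
      rfl, fun a => (hst a).trans (by omega)⟩
    · intro ok t hok ht
      rw [StackMachine.step, if_pos (by exact hok)]
      simp only [tapeCfg]
      rw [ht]
      rfl
    · intro k
      rcases hgap rfl with h | h
      · rw [h, halfCell_nil]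
        cases k <;> simp [consCell, halfCell_nil]
      · rw [Function.update_self, gapSucc]
        simp only [min_eq_left h]
        cases k
        · rw [halfCell_gap_succ_zero]; rfl
        · rw [halfCell_gap_succ]; rfl
  · refine ⟨Function.update gap (!s) 0, Function.update st (!s) (y :: st !s), ?_, ?_,
      Function.update_of_ne hns _ _, Function.update_of_ne hns _ _, ?_⟩
    · intro ok t hok ht
      rw [StackMachine.step, if_pos (by exact hok)]
      simp only [tapeCfg]
      rw [ht]
      rfl
    · intro k
      simp only [Function.update_self, Fin.val_zero]
      cases k with
      | zero => rw [halfCell_no_gap]; rfl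
      | succ k =>
        rw [halfCell_no_gap_succ, List.tail_cons, consCell]
        rcases hy (by simp) with h | h
        · rw [h, halfCell_nil, halfCell_nil]
        · rw [h]
    · intro a
      rcases eq_or_ne a (!s) with rfl | h
      · simpa using hst (!s)
      · rw [Function.update_of_ne h]
        exact (hst a).trans (by omega)

/-- The stacks and the gaps represent the tape. -/
def TapeRel (w : List AB) (c : M.Cfg) (d : (M.toStack G).Cfg) : Prop :=
  M.Reachable w c ∧ ∃ gap st, d = tapeCfg (.main c.state gap (c.tape c.pos)) st ∧
    ∀ s (k : ℕ), c.tape (c.pos + sgn s * (k + 1)) = halfCell (gap s) (st s) k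

theorem pos_add_ne (p : ℤ) (s : Bool) (k : ℕ) : p + sgn s * (k + 1) ≠ p := by
  intro h
  rcases sgn_eq s with hs | hs <;> rw [hs] at h <;> omega

/-- The head and the farthest letter both lie on the squares from 0 to |w| + 1. -/
theorem height_le (hspace : M.InputSpace) {w : List AB} {c : M.Cfg} (hc : M.Reachable w c)
    {gap : Bool → Fin (G + 1)} {st : Bool → List AB}
    (hcell : ∀ s (k : ℕ), c.tape (c.pos + sgn s * (k + 1)) = halfCell (gap s) (st s) k) :
    HeightLE (w.length + 1) st := by
  intro s
  rcases eq_or_ne (st s) [] with h | h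
  · simp [h]
  · have h1 := halfCell_last_ne_none (gap s) h
    rw [← hcell] at h1
    have h2 := hc.nonblank_bounds hspace h1
    have h3 := hspace w c hc
    have h4 := List.length_pos_of_ne_nil h
    have h5 : (((gap s).val + (st s).length - 1 : ℕ) : ℤ) = (gap s).val + (st s).length - 1 := by
      omega
    rw [h5] at h2
    rcases sgn_eq s with hs | hs <;> rw [hs] at h2 <;> omega

theorem move_reaches (hblock : M.SingleBlock) (hspace : M.InputSpace)
    (hG : ∀ w c, M.Reachable w c → ∀ (s : Bool) (d : ℤ), c.tape (c.pos - sgn s * d) ≠ none →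
      c.tape (c.pos - sgn s * (d - 1)) = none → d ≤ G)
    {w : List AB} {c : M.Cfg} {y : Option AB} {q : M.State} (s : Bool)
    (hc : M.Reachable w c) (hc' : M.Reachable w ⟨q, c.pos + sgn s, Function.update c.tape c.pos y⟩)
    {gap : Bool → Fin (G + 1)} {st : Bool → List AB}
    (hcell : ∀ s (k : ℕ), c.tape (c.pos + sgn s * (k + 1)) = halfCell (gap s) (st s) k)
    {t : TapeState M.State G} (ht : (M.toStack G).instr t = leaveInstr q gap s y) :
    ∃ d, TapeRel w ⟨q, c.pos + sgn s, Function.update c.tape c.pos y⟩ d ∧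
      Reaches₁ ((M.toStack G).step (HeightLE (w.length + 2))) (tapeCfg t st) d := by
  have hheight := height_le hspace hc hcell
  set tape' := Function.update c.tape c.pos y with htape'
  have ahead : ∀ k : ℕ, tape' (c.pos + sgn s + sgn s * (k + 1)) =
      halfCell (gap s) (st s) (k + 1) := by
    intro k
    have e : c.pos + sgn s + sgn s * (k + 1) = c.pos + sgn s * ((k + 1 : ℕ) + 1) := by
      push_cast; ring
    rw [e, htape', Function.update_of_ne (pos_add_ne _ _ _), hcell]
  have here : tape' (c.pos + sgn s) = halfCell (gap s) (st s) 0 := by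
    have e : c.pos + sgn s = c.pos + sgn s * ((0 : ℕ) + 1) := by push_cast; ring
    rw [e, htape', Function.update_of_ne (pos_add_ne _ _ _), hcell]
  have behind : ∀ k : ℕ, tape' (c.pos + sgn s + sgn (!s) * (k + 1)) =
      consCell y (halfCell (gap !s) (st !s)) k := by
    intro k
    cases k with
    | zero =>
      have e : c.pos + sgn s + sgn (!s) * ((0 : ℕ) + 1) = c.pos := by
        rw [sgn_not]; push_cast; ring
      rw [e, htape', Function.update_self]
      rfl
    | succ k =>
      have e : c.pos + sgn s + sgn (!s) * ((k + 1 : ℕ) + 1) = c.pos + sgn (!s) * (k + 1) := by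
        rw [sgn_not]; push_cast; ring
      rw [e, htape', Function.update_of_ne (pos_add_ne _ _ _), hcell]
      rfl
  have behind' : ∀ (k : ℕ) (d : ℤ), d = k + 1 → tape' (c.pos + sgn s - sgn s * d) =
      consCell y (halfCell (gap !s) (st !s)) k := by
    rintro k d rfl
    rw [← behind, sgn_not]
    congr 1
    ring
  -- After the move the top of the stack behind is at distance gap + 2, to which the bound `hG`
  -- applies.
  have hgap : y = none → st (!s) = [] ∨ (gap !s).val + 1 ≤ G := by
    rintro rfl
    by_contra! h
    have h1 := halfCell_ne_none (gap !s) h.1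
    have h2 := hG w _ hc' s ((gap !s).val + 2)
      (by
        dsimp only
        rw [behind' ((gap !s).val + 1) _ (by push_cast; ring)]
        exact h1)
      (by
        dsimp only
        rw [behind' (gap !s).val _ (by ring)]
        rcases (gap !s).val with _ | g
        · rfl
        · simp [consCell, halfCell])
    omega
  -- Otherwise a blank of the gap would separate `y` from the letters of the stack.
  have hy : y ≠ none → st (!s) = [] ∨ (gap !s).val = 0 := by
    intro hy
    by_contra! h
    obtain ⟨g, hg⟩ := Nat.exists_eq_succ_of_ne_zero h.2
    have h1 := halfCell_ne_none (gap !s) h.1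
    have e : ∀ k : ℕ, c.pos + sgn (!s) * k = c.pos + sgn s + sgn (!s) * (k + 1) := by
      intro k
      rw [sgn_not]; ring
    have h2 := blank_beyond (hblock w _ hc') (!s) c.pos 1 ((gap !s).val + 1)
      (by simpa [htape'] using hy) (by omega) (by omega)
      (by
        have := behind 1
        rw [← e] at this
        rw [hg] at this
        simpa [consCell, halfCell] using this)
    have h3 := behind ((gap !s).val + 1)
    rw [← e] at h3
    push_cast at h3
    exact h1 (h3.symm.trans h2)
  obtain ⟨gap₁, st₁, hstep₁, hcell₁, hgap₁, hst₁, hheight₁⟩ :=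
    leave_step (M := M) q gap s y st hgap hy hheight
  -- The push precedes the pop, so the height may be |w| + 2 in between.
  obtain ⟨gap₂, st₂, hstep₂, hcell₂, hgap₂, hst₂⟩ :=
    fetch_step (M := M) (HeightLE (w.length + 2)) q gap₁ s st₁ hheight₁
  refine ⟨_, ⟨hc', gap₂, st₂, ?_, ?_⟩, Reaches₁.cons
    (hstep₁ _ t (fun a => (hheight a).trans (by omega)) ht) (Reaches.of_step hstep₂)⟩
  · dsimp only
    rw [here, hgap₁, hst₁]
  · intro a k
    rcases bool_eq_or_eq_not a s with rfl | rfl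
    · dsimp only
      rw [hcell₂, ahead, hgap₁, hst₁]
    · dsimp only
      rw [behind, hgap₂, hst₂, hcell₁]

theorem toStack_simulates (hblock : M.SingleBlock) (hspace : M.InputSpace)
    (hG : ∀ w c, M.Reachable w c → ∀ (s : Bool) (d : ℤ), c.tape (c.pos - sgn s * d) ≠ none →
      c.tape (c.pos - sgn s * (d - 1)) = none → d ≤ G) (w : List AB) :
    Simulates M.step ((M.toStack G).step (HeightLE (w.length + 2))) (TapeRel w) := by
  rintro c d ⟨hc, gap, st, rfl, hcell⟩ c' hcc'
  have hc' := hc.next hcc'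
  obtain ⟨hh, rfl⟩ := step_eq_some hcc'
  have hacc : c.state ≠ M.accept := fun h => hh (.inl h)
  have hrej : c.state ≠ M.reject := fun h => hh (.inr h)
  have hinstr := toStack_instr (.main c.state gap (c.tape c.pos))
  simp only [tapeInstr, if_neg hacc, if_neg hrej] at hinstr
  rcases hm : (M.δ c.state (c.tape c.pos)).2.2 with _ | _ | _ <;> rw [hm] at hc' <;>
    simp only [hm] at hinstr
  · exact move_reaches hblock hspace hG false hc hc' hcell hinstr
  · refine ⟨_, ⟨hc', gap, st, rfl, ?_⟩, Reaches₁.of_step ?_⟩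
    · intro s k
      simp only [HeadMove.shift, add_zero]
      rw [Function.update_of_ne (pos_add_ne _ _ _), hcell]
    · have : HeightLE (w.length + 2) st :=
        fun a => (height_le hspace hc hcell a).trans (by omega)
      rw [StackMachine.step, if_pos (by exact this)]
      simp only [tapeCfg]
      rw [hinstr]
      simp [HeadMove.shift]
  · exact move_reaches hblock hspace hG true hc hc' hcell hinstr

theorem load_reaches (k : ℕ) (l r : List AB) (h : l.length + r.length ≤ k) :
    Reaches ((M.toStack G).step (HeightLE k)) (tapeCfg .unload (twoStacks l r))
      (tapeCfg (.main M.start 0 none) (twoStacks (r.reverse ++ l) [])) := by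
  have ok : ∀ l r : List AB, l.length + r.length ≤ k → HeightLE k (twoStacks l r) := by
    intro l r h a
    cases a <;> simp only [twoStacks] <;> omega
  induction r generalizing l with
  | nil =>
    refine Reaches.of_step ?_
    rw [StackMachine.step, if_pos (by exact (ok _ _ h))]
    simp only [tapeCfg]
    rw [toStack_instr]
    simp [tapeInstr]
    simp [twoStacks]
  | cons x r ih =>
    have h1 : (x :: l).length + r.length ≤ k := by simp at h ⊢; omega
    have h2 : l.length + r.length ≤ k := by simp at h ⊢; omega
    refine Reaches.cons (b := tapeCfg (.load x) (twoStacks l r)) ?_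
      (Reaches.cons (b := tapeCfg .unload (twoStacks (x :: l) r)) ?_ ?_)
    · rw [StackMachine.step, if_pos (by exact (ok _ _ h))]
      simp only [tapeCfg]
      rw [toStack_instr]
      simp [tapeInstr]
      simp [twoStacks]
    · rw [StackMachine.step, if_pos (by exact (ok _ _ h2))]
      simp only [tapeCfg]
      rw [toStack_instr]
      simp [tapeInstr]
      simp [twoStacks]
    · simpa using ih (x :: l) h1

/-- The verdicts of the Turing machine. -/
def Verdict (M : BinaryDTM) (c : M.Cfg) : Bool → Prop
  | true => c.state = M.accept
  | false => c.state = M.reject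

theorem tapeRel_init (w : List AB) :
    TapeRel (G := G) w (M.init w) (tapeCfg (.main M.start 0 none) (twoStacks w.reverse [])) := by
  refine ⟨.refl, 0, twoStacks w.reverse [], ?_, ?_⟩
  · have : inputTape w (w.length + 1) = none := by
      by_contra h
      have := inputTape_ne_none h
      omega
    simp only [init, this]
  · intro s k
    cases s
    · simp only [init, sgn, twoStacks, Pi.zero_apply, Fin.val_zero, halfCell, Nat.not_lt_zero,
        if_false, Nat.sub_zero]
      unfold inputTape
      split_ifs with h
      · symm
        rw [List.getElem?_eq_none_iff, List.length_reverse]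
        omega
      · rw [List.getElem?_reverse (by omega)]
        congr 1
        omega
    · simp only [twoStacks, halfCell_nil]
      by_contra h
      have h' : inputTape w (w.length + 1 + sgn true * (k + 1)) ≠ none := h
      have := inputTape_ne_none h'
      simp only [sgn] at this
      omega

theorem toStack_agrees (hblock : M.SingleBlock) (hspace : M.InputSpace)
    (hG : ∀ w c, M.Reachable w c → ∀ (s : Bool) (d : ℤ), c.tape (c.pos - sgn s * d) ≠ none →
      c.tape (c.pos - sgn s * (d - 1)) = none → d ≤ G) (w : List AB) :
    Agrees M.step M.Verdict (M.init w) ((M.toStack G).step (HeightLE (w.length + 2)))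
      (M.toStack G).Verdict ((M.toStack G).start, twoStacks [] w) := by
  have hload := load_reaches (M := M) (G := G) (w.length + 2) [] w (by simp)
  rw [List.append_nil] at hload
  refine Agrees.of_reaches hload
    ((toStack_simulates hblock hspace hG w).agrees ?_ (tapeRel_init w))
  rintro c d v ⟨-, gap, st, rfl, -⟩ hv
  refine ⟨_, .refl, ?_⟩
  show M.tapeInstr G (.main c.state gap (c.tape c.pos)) = .halt v
  cases v
  · have hv : c.state = M.reject := hv
    simp [tapeInstr, hv, M.accept_ne_reject.symm]
  · have hv : c.state = M.accept := hv
    simp [tapeInstr, hv]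

/-- Every computation has a verdict or diverges. -/
theorem verdict_or_diverges (M : BinaryDTM) (c : M.Cfg) :
    Leads M.step c (M.Verdict · true) ∨ Leads M.step c (M.Verdict · false) ∨ Diverges M.step c := by
  by_cases h : Diverges M.step c
  · exact .inr (.inr h)
  · unfold Diverges at h
    push Not at h
    obtain ⟨c', hc', h0⟩ := h
    by_cases hh : M.Halting c'.state
    · rcases hh with hh | hh
      · exact .inl ⟨c', hc', hh⟩
      · exact .inr (.inl ⟨c', hc', hh⟩)
    · rw [step_of_not_halting hh] at h0
      cases h0

end BinaryDTM

/-! ### The unary language -/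

/-- Bijective base 2 with digits 1 and 2 is binary with a leading 1, shifted by one: 2(c + 1) + d =
(2c + 1 + d) + 1. -/
theorem ofDigits_stack (l : List AB) :
    Nat.ofDigits 2 (l.map AB.digit ++ [1]) = stackCode l + 1 := by
  induction l with
  | nil => simp [stackCode]
  | cons x l ih =>
    simp only [List.map_cons, List.cons_append, Nat.ofDigits_cons, ih, stackCode]
    ring

theorem binaryValue_eq (w : List AB) : binaryValue w = stackCode (.b :: w.reverse) + 1 := by
  rw [← ofDigits_stack, binaryValue]
  simp [AB.digit]

/-- The number m - 1 is positive and even, so its stack is nonempty with top `b`, the closing digit.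
-/
theorem exists_binaryValue_eq (m : ℕ) (h3 : 3 ≤ m) (hodd : m % 2 = 1) :
    ∃ w, binaryValue w = m := by
  obtain ⟨l, hl⟩ := exists_stackCode_eq (m - 1)
  rcases l with _ | ⟨x, l⟩
  · simp [stackCode] at hl; omega
  · cases x
    · simp [stackCode, AB.digit] at hl; omega
    · exact ⟨l.reverse, by rw [binaryValue_eq, List.reverse_reverse, hl]; omega⟩

namespace TwoD1CA

open StateTransition

theorem not_accepts_of_leads_reject (D : TwoD1CA Unary) (x : List Unary)
    (h : Leads (D.step x) D.init (·.state = D.reject)) : ¬ D.Accepts x := by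
  intro ha
  obtain ⟨c, h1, h2⟩ := Leads.unique (fun c hc => by simp [step, hc])
    (fun c hc => by simp [step, hc]) ha h
  exact D.accept_ne_reject (h1.symm.trans h2)

theorem not_accepts_of_diverges (D : TwoD1CA Unary) (x : List Unary)
    (h : Diverges (D.step x) D.init) : ¬ D.Accepts x := by
  rintro ⟨c, hc, ha⟩
  exact h c hc (by simp [step, ha])

end TwoD1CA

theorem eq_unaryInput (x : List Unary) : x = FracMachine.unaryInput x.length :=
  List.eq_replicate_iff.2 ⟨rfl, fun _ _ => rfl⟩

theorem theorem5 (L : Language AB) (M : BinaryDTM) (hblock : M.SingleBlock)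
    (hspace : M.InputSpace) (hL : M.Recognizes L) :
    ∃ D : TwoD1CA Unary, D.Recognizes
      {x : List Unary | ∃ w ∈ L, x = List.replicate (100 ^ binaryValue w) Unary.a} := by
  obtain ⟨G, hG⟩ := BinaryDTM.exists_gap_bound hblock hspace
  let P := (M.toStack G).buffered
  let F := P.toFrac
  have key : ∀ w, F.auto.Accepts (FracMachine.unaryInput (100 ^ binaryValue w)) ↔ w ∈ L := by
    intro w
    have hm := binaryValue_eq w
    have hodd : binaryValue w % 2 = 1 := by rw [hm]; simp [stackCode, AB.digit]; omega
    have h3 : 3 ≤ binaryValue w := by rw [hm]; simp [stackCode, AB.digit]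
    have h1 := BinaryDTM.toStack_agrees hblock hspace hG w
    have h2 := StackMachine.buffered_agrees (M.toStack G) w hm
    have h4 := P.toFrac_agrees (binaryValue w) (P.start, StackMachine.twoStacks (.b :: w.reverse) [])
      (P.runCfg P.start .enter (register false (binaryValue w - 1) 0 0)) (by
        rw [hm]; rfl)
    have h5 := h4.of_reaches (StackMachine.prep_reaches (P := P) (binaryValue w) h3 hodd)
    have h6 := F.auto_agrees (100 ^ binaryValue w)
    have h := ((h1.trans h2).trans h5).trans h6
    rw [← hL w]
    constructor
    · intro hacc
      -- If `M` does not accept, it rejects or runs forever, and the automaton inherits either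
      -- behaviour.
      rcases M.verdict_or_diverges (M.init w) with hv | hv | hv
      · exact hv
      · exact absurd hacc (F.auto.not_accepts_of_leads_reject _ (h.1 false hv))
      · exact absurd hacc (F.auto.not_accepts_of_diverges _ (h.2 hv))
    · intro hacc
      exact h.1 true hacc
  refine ⟨F.auto, fun x => ⟨fun hacc => ?_, ?_⟩⟩
  · by_cases hx : ∃ m, 3 ≤ m ∧ m % 2 = 1 ∧ x.length = 100 ^ m
    · obtain ⟨m, h3, hodd, hx⟩ := hx
      obtain ⟨w, rfl⟩ := exists_binaryValue_eq m h3 hodd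
      have hx' := eq_unaryInput x
      rw [hx] at hx'
      rw [hx', key] at hacc
      exact ⟨w, hacc, hx'⟩
    · push Not at hx
      refine absurd hacc (F.auto.not_accepts_of_leads_reject _ ?_)
      rw [eq_unaryInput x]
      exact (F.auto_agrees x.length).1 false (StackMachine.prep_rejects x.length hx)
  · rintro ⟨w, hw, rfl⟩
    exact (key w).2 hw
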